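/- Let $A\in\mathbb R^{m\times n}$, $G\in\mathbb R^{l\times n}$, and consider the problem $$\min f(x)\quad\text{subject to } Ax=b,\ x\in P=\{x\in\mathbb R^n : Gx\preceq h\},\qquad(1.1)$$ where the feasible set $\{x\in P: Ax=b\}$ is nonempty, $f:\mathbb R^n\to\mathbb R$ is differentiable, $\|\nabla f(x)-\nabla f(x')\|\le L_f\|x-x'\|$ for all $x,x'\in P$ (with $L_f\ge 0$), and $f(x)>\underline f$ for all feasible $x$, where $\underline f\in\mathbb R$. For $\rho\ge0$ and $p>0$ put $$K(x,z;y)=f(x)+y^T(Ax-b)+\tfrac{\rho}{2}\|Ax-b\|^2+\tfrac p2\|x-z\|^2 .$$ The S-prox-ALM with parameters $c,\alpha,\beta>0$ starts from arbitrary $x^0,z^0\in\mathbb R^n$, $y^0\in\mathbb R^m$ and iterates $$y^{t+1}=y^t+\alpha(Ax^t-b),\quad x^{t+1}=\mathrm{proj}_P\bigl(x^t-c\nabla_xK(x^t,z^t;y^{t+1})\bigr),\quad z^{t+1}=z^t+\beta(x^{t+1}-z^t).$$ A pair $(x,y)$ is a KKT point of (1.1) if there is $\mu\succeq0$ in $\mathbb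 R^l$ with $\nabla f(x)+A^Ty+G^T\mu=0$, $Ax=b$, $Gx\preceq h$ and $\mu_i(Gx-h)_i=0$ for all $i$. It is an $\epsilon$-stationary solution if $\|Ax-b\|\le\epsilon$ and some $v\in\nabla f(x)+A^Ty+\partial\iota(x)$ has $\|v\|\le\epsilon$, where $\iota$ is the indicator function of $P$ ($0$ on $P$, $+\infty$ elsewhere) and $\partial\iota$ its subdifferential. Finally let $$\phi^0=K(x^0,z^0;y^0)-2\min_{x\in P}K(x,z^0;y^0)+2\min_{x\in P,\,Ax=b}\bigl\{f(x)+\tfrac p2\|x-z^0\|^2\bigr\}.$$ **Theorem.** Let $p\ge3L_f$, $p>L_f$, $\rho\ge0$ and $0<c<1/(L_f+\rho\sigma_{\max}^2(A)+p)$, where $\sigma_{\max}(A)$ is the largest singular value of $A$. Then there are $\alpha'>0$ and $\theta>0$, depending only on $L_f,A,G,p,\rho,c$, such that for all $0<\alpha<\alpha'$ and all $0<\beta<\beta':=\theta\alpha$ the following hold. 1. Every limit point of the sequence $\{(x^t,y^t)\}$ generated by the S-prox-ALM is a KKT point of (1.1). 2. There is a constant $B>0$ such that for every integer $t>0$ there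 is $s\in\{0,1,\dots,t-1\}$ for which $(x^{s+1},y^{s+1})$ is a $\sqrt B/\sqrt t$-stationary solution of (1.1); and for every $\epsilon>0$ there is an integer $0\le s<B/\epsilon^2$ for which $(x^{s+1},y^{s+1})$ is an $\epsilon$-stationary solution. If $x^0\in P$, one can take $B=\kappa\,(\phi^0-\underline f)$, where $\kappa>0$ depends only on $p,\rho,c,\alpha,\beta,L_f,A,G$. -/

import Mathlib

open Filter Topology

namespace SProxALM

noncomputable section

/-- Euclidean space `ℝⁿ`. -/
abbrev Vec (n : ℕ) : Type := EuclideanSpace ℝ (Fin n)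

/-- The matrix-vector product `M x`, as a map of Euclidean spaces. -/
abbrev mulV {m n : ℕ} (M : Matrix (Fin m) (Fin n) ℝ) (x : Vec n) : Vec m :=
  Matrix.toEuclideanLin M x

/-- The largest singular value of `M` (singular values are listed in decreasing order from
index `0`; the value is `0` when `M` has no columns). -/
def sigmaMax {m n : ℕ} (M : Matrix (Fin m) (Fin n) ℝ) : ℝ :=
  (Matrix.toEuclideanLin M).singularValues 0

/-- The polyhedral set `P = {x | G x ≤ h}` (componentwise). -/
def polyhedron {n l : ℕ} (G : Matrix (Fin l) (Fin n) ℝ) (h : Vec l) : Set (Vec n) :=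
  {x | ∀ i, mulV G x i ≤ h i}

/-- The feasible set `{x ∈ P | A x = b}`. -/
def feasibleSet {n m l : ℕ} (A : Matrix (Fin m) (Fin n) ℝ) (b : Vec m)
    (G : Matrix (Fin l) (Fin n) ℝ) (h : Vec l) : Set (Vec n) :=
  {x | x ∈ polyhedron G h ∧ mulV A x = b}

/-- `w` is a projection of `v` onto `S`: a nearest point of `S` in the Euclidean norm. -/
def IsProjOn {n : ℕ} (S : Set (Vec n)) (v w : Vec n) : Prop :=
  w ∈ S ∧ ∀ u ∈ S, ‖v - w‖ ≤ ‖v - u‖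

/-- The augmented Lagrangian `L_ρ(x; y) = f(x) + yᵀ(Ax - b) + (ρ/2)‖Ax - b‖²`. -/
def augLag {n m : ℕ} (f : Vec n → ℝ) (A : Matrix (Fin m) (Fin n) ℝ) (b : Vec m) (ρ : ℝ)
    (x : Vec n) (y : Vec m) : ℝ :=
  f x + inner ℝ y (mulV A x - b) + ρ / 2 * ‖mulV A x - b‖ ^ 2

/-- The proximal augmented Lagrangian `K(x, z; y) = L_ρ(x; y) + (p/2)‖x - z‖²`. -/
def proxLag {n m : ℕ} (f : Vec n → ℝ) (A : Matrix (Fin m) (Fin n) ℝ) (b : Vec m) (ρ p : ℝ)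
    (x z : Vec n) (y : Vec m) : ℝ :=
  augLag f A b ρ x y + p / 2 * ‖x - z‖ ^ 2

/-- The sequences `x, y, z` are generated by the S-prox-ALM, from arbitrary initial points. -/
structure IsSProxALM {n m l : ℕ} (f : Vec n → ℝ) (A : Matrix (Fin m) (Fin n) ℝ) (b : Vec m)
    (G : Matrix (Fin l) (Fin n) ℝ) (h : Vec l) (ρ p c α β : ℝ)
    (x : ℕ → Vec n) (y : ℕ → Vec m) (z : ℕ → Vec n) : Prop where
  y_step : ∀ t, y (t + 1) = y t + α • (mulV A (x t) - b)
  x_step : ∀ t, IsProjOn (polyhedron G h)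
    (x t - c • gradient (fun u => proxLag f A b ρ p u (z t) (y (t + 1))) (x t)) (x (t + 1))
  z_step : ∀ t, z (t + 1) = z t + β • (x (t + 1) - z t)

/-- `(x, y)` is a KKT point of `min f(x)` subject to `A x = b`, `G x ≤ h`. -/
def IsKKTPoint {n m l : ℕ} (f : Vec n → ℝ) (A : Matrix (Fin m) (Fin n) ℝ) (b : Vec m)
    (G : Matrix (Fin l) (Fin n) ℝ) (h : Vec l) (x : Vec n) (y : Vec m) : Prop :=
  ∃ μ : Vec l,
    gradient f x + mulV A.transpose y + mulV G.transpose μ = 0 ∧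
    mulV A x - b = 0 ∧
    (∀ i, mulV G x i ≤ h i) ∧
    (∀ i, 0 ≤ μ i) ∧
    (∀ i, μ i * (mulV G x i - h i) = 0)

open Classical in
/-- The indicator function of convex analysis: `0` on `S` and `+∞` off `S`. -/
def indicatorFn {n : ℕ} (S : Set (Vec n)) (x : Vec n) : EReal :=
  if x ∈ S then 0 else ⊤

/-- The subdifferential of an extended-real-valued function (empty where the function
is `+∞`). -/
def subdiff {n : ℕ} (g : Vec n → EReal) (x : Vec n) : Set (Vec n) :=
  {w | g x ≠ ⊤ ∧ ∀ u, g x + ((inner ℝ w (u - x) : ℝ) : EReal) ≤ g u}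

/-- `(x, y)` is an `ε`-stationary solution: `‖A x - b‖ ≤ ε`, and some
`v ∈ ∇f(x) + Aᵀ y + ∂ι(x)` has `‖v‖ ≤ ε`, where `ι` is the indicator function of `P`. -/
def IsEpsStationary {n m l : ℕ} (f : Vec n → ℝ) (A : Matrix (Fin m) (Fin n) ℝ) (b : Vec m)
    (G : Matrix (Fin l) (Fin n) ℝ) (h : Vec l) (ε : ℝ) (x : Vec n) (y : Vec m) : Prop :=
  ‖mulV A x - b‖ ≤ ε ∧
  ∃ w ∈ subdiff (indicatorFn (polyhedron G h)) x,
    ‖gradient f x + mulV A.transpose y + w‖ ≤ ε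

/-- The dual function `d(y, z) = min_{x ∈ P} K(x, z; y)`. -/
def dualFn {n m l : ℕ} (f : Vec n → ℝ) (A : Matrix (Fin m) (Fin n) ℝ) (b : Vec m)
    (G : Matrix (Fin l) (Fin n) ℝ) (h : Vec l) (ρ p : ℝ) (y : Vec m) (z : Vec n) : ℝ :=
  sInf ((fun x => proxLag f A b ρ p x z y) '' polyhedron G h)

/-- The proximal function `P(z) = min_{x ∈ P, A x = b} {f(x) + (p/2)‖x - z‖²}`. -/
def proxFn {n m l : ℕ} (f : Vec n → ℝ) (A : Matrix (Fin m) (Fin n) ℝ) (b : Vec m)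
    (G : Matrix (Fin l) (Fin n) ℝ) (h : Vec l) (p : ℝ) (z : Vec n) : ℝ :=
  sInf ((fun x => f x + p / 2 * ‖x - z‖ ^ 2) '' feasibleSet A b G h)

/-- The potential function `φ(x, y, z) = K(x, z; y) - 2 d(y, z) + 2 P(z)`. -/
def potential {n m l : ℕ} (f : Vec n → ℝ) (A : Matrix (Fin m) (Fin n) ℝ) (b : Vec m)
    (G : Matrix (Fin l) (Fin n) ℝ) (h : Vec l) (ρ p : ℝ)
    (x : Vec n) (y : Vec m) (z : Vec n) : ℝ :=
  proxLag f A b ρ p x z y - 2 * dualFn f A b G h ρ p y z + 2 * proxFn f A b G h p z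

end

end SProxALM

/-! The proof is a Lyapunov argument with the potential `φ = K - 2d + 2P`, where `d` is the dual
function and `P` the proximal value function. Write `X` for the minimizer of `K(·, z; y)` over the
polyhedron and `Y` for the feasible minimizer defining `P(z)`. A projected gradient step lowers `K`;
the multiplier step raises both `K` and `d`, and completing the square leaves `-α‖AX - b‖²` plus an
error `α‖A(x - X)‖²`; the move of `z` gains a multiple of `β‖x' - z‖²` up to a cross term in `X' -
Y`, with `X'` the minimizer for the new `z`.

Two error bounds absorb the bad terms. Strong convexity of `K` in `x` gives `‖x' - X‖ ≤ σ‖x - x'‖`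
(`norm_sub_minimizer_le`). The dual bound `‖X - Y‖ ≤ τ‖AX - b‖` (`norm_minimizer_sub_prox_le`) is
where polyhedrality enters: `X` and `Y` are projections onto the slices `Au = AX` and `Au = b`, and
such projections are Lipschitz in the right-hand side with a constant depending on `A` and `G` only
(`exists_lipschitz_projection`). No constraint qualification or bound on the multipliers is needed.

For small `α` and `β/α`, each step lowers `φ` by a multiple of `‖x - x'‖² + ‖x' - z‖² + ‖AX - b‖²`
(`potential_step`), and these quantities control the stationarity residual (`isEpsStationary_step`).
As `φ` stays above `flow`, squared residuals are summable: the smallest of `t` of them is at most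
the average, and all tend to zero, so limit points are KKT. -/

namespace SProxALM

/-! ### Finitely generated cones and Lipschitz stability of projections onto polyhedra -/

section Polyhedral

variable {ι E : Type*} [NormedAddCommGroup E] [InnerProductSpace ℝ E]

/-- The convex cone generated by the vectors `g i`, `i ∈ s`. -/
def coneOf (g : ι → E) (s : Finset ι) : Set E :=
  {q | ∃ μ : ι → ℝ, (∀ i, 0 ≤ μ i) ∧ q = ∑ i ∈ s, μ i • g i}

/-- The polyhedron cut out by the inequalities `⟪g i, u⟫ ≤ h i`. -/
def halfspaces (g : ι → E) (h : ι → ℝ) : Set E := {u | ∀ i, inner ℝ (g i) u ≤ h i}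

theorem coneOf_mono (g : ι → E) {s t : Finset ι} (hst : s ⊆ t) : coneOf g s ⊆ coneOf g t := by
  classical
  rintro q ⟨μ, hμ, rfl⟩
  refine ⟨fun i => if i ∈ s then μ i else 0, fun i => ?_, ?_⟩
  · by_cases hi : i ∈ s <;> simp [hi, hμ i]
  · rw [← Finset.sum_subset hst (fun i _ hi => by simp [hi])]
    exact Finset.sum_congr rfl fun i hi => by simp [hi]

/-- A conic combination of linearly dependent vectors needs one vector less. -/
theorem coneOf_subset_iUnion_erase [DecidableEq ι] (g : ι → E) (s : Finset ι) (w : ι → ℝ)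
    (hw : ∑ i ∈ s, w i • g i = 0) {j : ι} (hj : j ∈ s) (hwj : 0 < w j) :
    coneOf g s ⊆ ⋃ i ∈ s, coneOf g (s.erase i) := by
  rintro q ⟨μ, hμ, rfl⟩
  -- Carathéodory's reduction: subtracting the multiple of `w` given by the smallest ratio `μ i / w
  -- i` keeps all coefficients nonnegative and cancels the one at `k`.
  obtain ⟨k, hk, hkmin⟩ := Finset.exists_min_image (s.filter fun i => 0 < w i)
    (fun i => μ i / w i) ⟨j, by simp [hj, hwj]⟩
  simp only [Finset.mem_filter] at hk hkmin
  simp only [Set.mem_iUnion]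
  have hnn : ∀ i ∈ s, 0 ≤ μ i - μ k / w k * w i := by
    intro i hi
    rcases le_or_gt (w i) 0 with h0 | h0
    · have : μ k / w k * w i ≤ 0 :=
        mul_nonpos_of_nonneg_of_nonpos (div_nonneg (hμ k) hk.2.le) h0
      linarith [hμ i]
    · have := hkmin i ⟨hi, h0⟩
      rw [le_div_iff₀ h0] at this
      linarith
  refine ⟨k, hk.1, fun i => if i ∈ s then μ i - μ k / w k * w i else 0, fun i => ?_, ?_⟩
  · by_cases hi : i ∈ s
    · simpa [hi] using hnn i hi
    · simp [hi]
  · have h1 : ∑ i ∈ s, μ i • g i = ∑ i ∈ s, (μ i - μ k / w k * w i) • g i := by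
      have : ∑ i ∈ s, (μ i - μ k / w k * w i) • g i
          = ∑ i ∈ s, μ i • g i - (μ k / w k) • ∑ i ∈ s, w i • g i := by
        rw [Finset.smul_sum, ← Finset.sum_sub_distrib]
        exact Finset.sum_congr rfl fun i _ => by rw [sub_smul, mul_smul]
      rw [this, hw, smul_zero, sub_zero]
    rw [h1, ← Finset.add_sum_erase _ _ hk.1]
    have h2 : μ k - μ k / w k * w k = 0 := by
      rw [div_mul_cancel₀ _ hk.2.ne', sub_self]
    rw [h2, zero_smul, zero_add]
    exact Finset.sum_congr rfl fun i hi => by simp [Finset.mem_of_mem_erase hi]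

/-- Finitely generated cones are closed. -/
theorem isClosed_coneOf (g : ι → E) (s : Finset ι) : IsClosed (coneOf g s) := by
  classical
  -- For independent generators the cone is the image of an orthant under a closed embedding;
  -- otherwise it is a finite union of cones with one generator less.
  induction s using Finset.strongInduction with
  | H s ih =>
    by_cases hli : LinearIndependent ℝ (fun i : s => g i)
    · have hinj : Function.Injective (Fintype.linearCombination ℝ (fun i : s => g i)) :=
        hli.fintypeLinearCombination_injective
      have hemb := LinearMap.isClosedEmbedding_of_injective (LinearMap.ker_eq_bot.2 hinj)
      have hcl : IsClosed {μ : s → ℝ | ∀ i, 0 ≤ μ i} := by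
        simp only [Set.ofPred_forall]
        exact isClosed_iInter fun i => isClosed_le continuous_const (continuous_apply i)
      have himg := hemb.isClosedMap _ hcl
      convert himg using 1
      ext q
      constructor
      · rintro ⟨μ, hμ, rfl⟩
        refine ⟨fun i => μ i, fun i => hμ i, ?_⟩
        rw [Fintype.linearCombination_apply, ← Finset.sum_coe_sort s]
      · rintro ⟨μ, hμ, rfl⟩
        refine ⟨fun i => if hi : i ∈ s then μ ⟨i, hi⟩ else 0, fun i => ?_, ?_⟩
        · by_cases hi : i ∈ s
          · simpa [hi] using hμ ⟨i, hi⟩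
          · simp [hi]
        · rw [Fintype.linearCombination_apply, ← Finset.sum_coe_sort s]
          exact Finset.sum_congr rfl fun i _ => by simp
    · rw [Fintype.linearIndependent_iff] at hli
      push Not at hli
      obtain ⟨w₀, hw₀, ⟨j, hj⟩, hne⟩ := hli
      obtain ⟨w, hw, hwj⟩ : ∃ w : ι → ℝ, ∑ i ∈ s, w i • g i = 0 ∧ 0 < w j := by
        set w' : ι → ℝ := fun i => if hi : i ∈ s then w₀ ⟨i, hi⟩ else 0 with hw'
        have h0 : ∑ i ∈ s, w' i • g i = 0 := by
          rw [← hw₀, ← Finset.sum_coe_sort s]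
          exact Finset.sum_congr rfl fun i _ => by simp [hw']
        have hj' : w' j ≠ 0 := by simpa [hw', hj] using hne
        rcases lt_or_gt_of_ne hj' with hlt | hgt
        · exact ⟨fun i => - w' i, by simp [neg_smul, h0], by simpa using hlt⟩
        · exact ⟨w', h0, hgt⟩
      have heq : coneOf g s = ⋃ i ∈ s, coneOf g (s.erase i) := by
        refine (coneOf_subset_iUnion_erase g s w hw hj hwj).antisymm ?_
        exact Set.iUnion₂_subset fun i _ => coneOf_mono g (Finset.erase_subset i s)
      rw [heq]
      exact s.finite_toSet.isClosed_biUnion fun i hi => ih _ (Finset.erase_ssubset hi)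

/-- Farkas' lemma for finitely generated cones. -/
theorem mem_coneOf_of_forall_inner_nonneg [CompleteSpace E] (g : ι → E) (s : Finset ι) (q : E)
    (hq : ∀ w, (∀ i ∈ s, 0 ≤ inner ℝ (g i) w) → 0 ≤ inner ℝ q w) : q ∈ coneOf g s := by
  classical
  let C : ProperCone ℝ E :=
    { carrier := coneOf g s
      add_mem' := by
        rintro _ _ ⟨μ, hμ, rfl⟩ ⟨ν, hν, rfl⟩
        exact ⟨fun i => μ i + ν i, fun i => add_nonneg (hμ i) (hν i), by
          simp [add_smul, Finset.sum_add_distrib]⟩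
      zero_mem' := ⟨0, fun _ => le_rfl, by simp⟩
      smul_mem' := by
        rintro r _ ⟨μ, hμ, rfl⟩
        exact ⟨fun i => (r : ℝ) * μ i, fun i => mul_nonneg r.2 (hμ i), by
          simp [Finset.smul_sum, mul_smul]⟩
      isClosed' := isClosed_coneOf g s }
  by_contra hmem
  obtain ⟨w, hw, hneg⟩ := C.hyperplane_separation' (x₀ := q) hmem
  refine absurd (hq w fun i hi => hw (g i) ?_) (not_le.2 hneg)
  refine ⟨fun k => if k = i then 1 else 0, fun k => by by_cases hk : k = i <;> simp [hk], ?_⟩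
  simp [hi]

/-- The normal cone of a polyhedron at one of its points is generated by the normals of the
active inequalities. -/
theorem mem_coneOf_of_forall_inner_le [Fintype ι] [CompleteSpace E] (g : ι → E) (h : ι → ℝ) {u q : E}
    (hu : u ∈ halfspaces g h) (hq : ∀ v ∈ halfspaces g h, inner ℝ q (v - u) ≤ 0) :
    q ∈ coneOf g (Finset.univ.filter fun i => inner ℝ (g i) u = h i) := by
  apply mem_coneOf_of_forall_inner_nonneg
  intro w hw
  -- A small step from `u` along `-w` stays in the polyhedron: active constraints do not increase,
  -- inactive ones have slack. Testing `q` there gives its sign on `w`.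
  have hev : ∀ᶠ ε : ℝ in 𝓝[>] 0, ∀ i, inner ℝ (g i) (u - ε • w) ≤ h i := by
    rw [eventually_all]
    intro i
    by_cases hi : inner ℝ (g i) u = h i
    · filter_upwards [self_mem_nhdsWithin] with ε hε
      have := hw i (by simp [hi])
      rw [inner_sub_right, inner_smul_right, hi]
      have := mul_nonneg (le_of_lt hε) this
      linarith
    · have hlt : inner ℝ (g i) u < h i := lt_of_le_of_ne (hu i) hi
      have hc : Tendsto (fun ε : ℝ => inner ℝ (g i) (u - ε • w)) (𝓝 0)
          (𝓝 (inner ℝ (g i) (u - (0 : ℝ) • w))) := by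
        apply Continuous.tendsto
        fun_prop
      rw [zero_smul, sub_zero] at hc
      exact ((hc.eventually_lt_const hlt).filter_mono nhdsWithin_le_nhds).mono
        fun ε hε => hε.le
  obtain ⟨ε, hε, hε0⟩ := (hev.and self_mem_nhdsWithin).exists
  have := hq _ hε
  rw [sub_sub_cancel_left, inner_neg_right, inner_smul_right] at this
  exact nonneg_of_mul_nonneg_right (by linarith) hε0

theorem isClosed_halfspaces (g : ι → E) (h : ι → ℝ) : IsClosed (halfspaces g h) := by
  simp only [halfspaces, Set.ofPred_forall]
  exact isClosed_iInter fun i => isClosed_le (by fun_prop) continuous_const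

theorem convex_halfspaces (g : ι → E) (h : ι → ℝ) : Convex ℝ (halfspaces g h) := by
  intro u hu v hv a b ha hb hab i
  rw [inner_add_right, inner_smul_right, inner_smul_right]
  have h1 := mul_le_mul_of_nonneg_left (hu i) ha
  have h2 := mul_le_mul_of_nonneg_left (hv i) hb
  calc _ ≤ a * h i + b * h i := add_le_add h1 h2
    _ = h i := by rw [← add_mul, hab, one_mul]

/-- A function that is Lipschitz on each member of a finite closed cover of `[0, 1]` is Lipschitz
between the endpoints. -/
theorem norm_sub_le_of_finite_closed_cover {κ X : Type*} [Finite κ] [NormedAddCommGroup X]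
    (U : ℝ → X) (D : κ → Set ℝ)
    (C : ℝ) (hD : ∀ k, IsClosed (D k)) (hcov : Set.Icc 0 1 ⊆ ⋃ k, D k)
    (hL : ∀ k, ∀ s ∈ D k, ∀ t ∈ D k, ‖U s - U t‖ ≤ C * |s - t|) : ‖U 1 - U 0‖ ≤ C := by
  have hcont : ∀ k, ContinuousOn U (D k) := by
    intro k
    have : LipschitzOnWith (Real.toNNReal C) U (D k) := by
      refine LipschitzOnWith.of_dist_le_mul fun s hs t ht => ?_
      rw [dist_eq_norm, Real.dist_eq]
      exact (hL k s hs t ht).trans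
        (mul_le_mul_of_nonneg_right (Real.le_coe_toNNReal C) (abs_nonneg _))
    exact this.continuousOn
  set S : Set ℝ := {t | ‖U t - U 0‖ ≤ C * t} with hS
  have hclosed : IsClosed (S ∩ Set.Icc 0 1) := by
    have heq : S ∩ Set.Icc 0 1
        = (⋃ k, D k ∩ {t | ‖U t - U 0‖ - C * t ∈ Set.Iic 0}) ∩ Set.Icc 0 1 := by
      ext t
      constructor
      · rintro ⟨ht, ht'⟩
        obtain ⟨k, hk⟩ := Set.mem_iUnion.1 (hcov ht')
        exact ⟨Set.mem_iUnion.2 ⟨k, hk, Set.mem_Iic.2 (sub_nonpos.2 (Set.mem_ofPred.1 ht))⟩, ht'⟩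
      · rintro ⟨ht, ht'⟩
        obtain ⟨k, hk, hk'⟩ := Set.mem_iUnion.1 ht
        exact ⟨Set.mem_ofPred.2 (sub_nonpos.1 (Set.mem_Iic.1 (Set.mem_ofPred.1 hk'))), ht'⟩
    rw [heq]
    refine IsClosed.inter (isClosed_iUnion_of_finite fun k => ?_) isClosed_Icc
    refine ContinuousOn.preimage_isClosed_of_isClosed ?_ (hD k) isClosed_Iic
    exact (((hcont k).sub continuousOn_const).norm).sub (by fun_prop)
  have hsub : Set.Icc (0 : ℝ) 1 ⊆ S := by
    refine hclosed.Icc_subset_of_forall_exists_gt (by simp [hS]) ?_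
    rintro t ⟨ht, ht0, ht1⟩ y hy
    -- Since the pieces are closed and finitely many, any piece containing a point `s` close to `t`
    -- also contains `t`, so the bound of a single piece carries the estimate past `t`.
    have hev : ∀ᶠ s in 𝓝[>] t, ∀ k, s ∈ D k → t ∈ D k := by
      rw [eventually_all]
      intro k
      by_cases hk : t ∈ D k
      · exact Eventually.of_forall fun _ _ => hk
      · exact ((hD k).isOpen_compl.eventually_mem hk).filter_mono nhdsWithin_le_nhds
          |>.mono fun s hs hs' => absurd hs' hs
    have hlt : t < min y 1 := lt_min hy ht1
    obtain ⟨s, hs, hsI⟩ := (hev.and (Ioc_mem_nhdsGT hlt)).exists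
    obtain ⟨k, hk⟩ := Set.mem_iUnion.1
      (hcov (show s ∈ Set.Icc (0 : ℝ) 1 from ⟨ht0.trans hsI.1.le, hsI.2.trans (min_le_right _ _)⟩))
    refine ⟨s, ?_, hsI.1, hsI.2.trans (min_le_left _ _)⟩
    have h1 := hL k s hk t (hs k hk)
    rw [abs_of_pos (sub_pos.2 hsI.1)] at h1
    calc ‖U s - U 0‖ ≤ ‖U s - U t‖ + ‖U t - U 0‖ := norm_sub_le_norm_sub_add_norm_sub _ _ _
      _ ≤ C * (s - t) + C * t := add_le_add h1 ht
      _ = C * s := by ring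
  simpa [hS] using hsub (Set.right_mem_Icc.2 zero_le_one)

/-- Testing each inequality at the other point and adding gives `‖u - v‖² ≤ 0`. This identifies the
projection from its variational inequality. -/
theorem eq_of_inner_sub_le {S : Set E} {w u v : E} (hu : u ∈ S) (hv : v ∈ S)
    (hu' : ∀ a ∈ S, inner ℝ (w - u) (a - u) ≤ 0) (hv' : ∀ a ∈ S, inner ℝ (w - v) (a - v) ≤ 0) :
    u = v := by
  have h1 := hu' v hv
  have h2 := hv' u hu
  have h3 : inner ℝ (u - v) (u - v) = inner ℝ (w - u) (v - u) + inner ℝ (w - v) (u - v) := by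
    rw [← neg_sub u v, inner_neg_right, ← sub_eq_neg_add, ← inner_sub_left]
    congr 1
    abel
  have h4 : inner ℝ (u - v) (u - v) ≤ (0 : ℝ) := by linarith
  exact sub_eq_zero.1 (inner_self_eq_zero.1 (le_antisymm h4 real_inner_self_nonneg))

/-- A vector in the span of `g i`, `i ∈ s`, is controlled by its inner products with them. -/
theorem exists_norm_le_of_mem_span (g : ι → E) (s : Finset ι) :
    ∃ C : ℝ, 0 ≤ C ∧ ∀ v ∈ Submodule.span ℝ (g '' s), ∀ r : ℝ,
      (∀ i ∈ s, |inner ℝ (g i) v| ≤ r) → 0 ≤ r → ‖v‖ ≤ C * r := by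
  set V := Submodule.span ℝ (g '' s) with hV
  have : FiniteDimensional ℝ V := FiniteDimensional.span_of_finite ℝ (s.finite_toSet.image g)
  -- Injective on the span, since a vector there orthogonal to every generator is orthogonal to
  -- itself; finite dimension then yields an antilipschitz constant.
  let T : V →ₗ[ℝ] (s → ℝ) := LinearMap.pi fun i => (innerₛₗ ℝ (g i)).comp V.subtype
  have hT : LinearMap.ker T = ⊥ := by
    rw [LinearMap.ker_eq_bot']
    rintro ⟨v, hv⟩ hv0
    have hperp : ∀ a ∈ V, inner ℝ a v = 0 := by
      intro a ha
      induction ha using Submodule.span_induction with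
      | mem a ha =>
        obtain ⟨i, hi, rfl⟩ := ha
        exact congrFun hv0 ⟨i, hi⟩
      | zero => simp
      | add a b _ _ ha hb => rw [inner_add_left, ha, hb, add_zero]
      | smul r a _ ha => rw [inner_smul_left, ha, mul_zero]
    have := hperp v hv
    exact Subtype.ext (inner_self_eq_zero.1 this)
  obtain ⟨K, -, hK⟩ := T.exists_antilipschitzWith hT
  refine ⟨K, K.2, fun v hv r hr hr0 => ?_⟩
  have h1 := hK.le_mul_dist (⟨v, hv⟩ : V) 0
  rw [dist_zero_right, map_zero, dist_zero_right] at h1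
  refine h1.trans (mul_le_mul_of_nonneg_left ?_ K.2)
  rw [pi_norm_le_iff_of_nonneg hr0]
  exact fun i => hr i i.2

/-- The projection onto a polyhedron depends Lipschitz-continuously on the right-hand side, with
a constant depending on the normals only. -/
theorem exists_lipschitz_projection [Fintype ι] [FiniteDimensional ℝ E] (g : ι → E) :
    ∃ C : ℝ, 0 ≤ C ∧ ∀ (h h' : ι → ℝ) (w u u' : E),
      u ∈ halfspaces g h → (∀ v ∈ halfspaces g h, inner ℝ (w - u) (v - u) ≤ 0) →
      u' ∈ halfspaces g h' → (∀ v ∈ halfspaces g h', inner ℝ (w - u') (v - u') ≤ 0) →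
      ‖u' - u‖ ≤ C * ‖h' - h‖ := by
  classical
  choose K hK0 hK using fun s : Finset ι => exists_norm_le_of_mem_span g s
  -- The sum over all subsets serves every possible active set at once.
  refine ⟨∑ s, K s, Finset.sum_nonneg fun s _ => hK0 s, ?_⟩
  intro h h' w u u' hu huw hu' huw'
  set C := ∑ s, K s
  have hKC : ∀ s, K s ≤ C := fun s =>
    Finset.single_le_sum (f := K) (fun s _ => hK0 s) (Finset.mem_univ s)
  let hh : ℝ → ι → ℝ := fun t => h + t • (h' - h)
  have hhc : Continuous hh := by fun_prop
  -- The part of the projection path, as the right-hand side moves from `h` to `h'`, whose normal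
  -- vector is generated by the active constraints `s`. Two such projections differ by a vector in
  -- the span of these normals, with prescribed inner products, hence the Lipschitz bound.
  let Z : Finset ι → Set (ℝ × E) := fun s =>
    {q | q.1 ∈ Set.Icc (0 : ℝ) 1 ∧ q.2 ∈ halfspaces g (hh q.1) ∧
      (∀ i ∈ s, inner ℝ (g i) q.2 = hh q.1 i) ∧ w - q.2 ∈ coneOf g s}
  have hZL : ∀ s, ∀ a ∈ Z s, ∀ b ∈ Z s, ‖a.2 - b.2‖ ≤ C * ‖h' - h‖ * |a.1 - b.1| := by
    rintro s ⟨t, a⟩ ⟨-, -, hta, μ, hμ, hμa⟩ ⟨t', b⟩ ⟨-, -, htb, ν, hν, hνb⟩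
    have hspan : a - b ∈ Submodule.span ℝ (g '' s) := by
      have : a - b = ∑ i ∈ s, (ν i - μ i) • g i := by
        simp only [sub_smul, Finset.sum_sub_distrib]
        rw [← hμa, ← hνb]
        abel
      rw [this]
      exact Submodule.sum_mem _ fun i hi => Submodule.smul_mem _ _
        (Submodule.subset_span ⟨i, hi, rfl⟩)
    have h1 := hK s (a - b) hspan (‖h' - h‖ * |t - t'|) ?_ (by positivity)
    · calc ‖a - b‖ ≤ K s * (‖h' - h‖ * |t - t'|) := h1
        _ ≤ C * (‖h' - h‖ * |t - t'|) := mul_le_mul_of_nonneg_right (hKC s) (by positivity)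
        _ = _ := by ring
    · intro i hi
      have e1 := hta i hi
      have e2 := htb i hi
      simp only at e1 e2
      rw [inner_sub_right, e1, e2]
      have : hh t i - hh t' i = (h' - h) i * (t - t') := by simp [hh]; ring
      rw [this, abs_mul]
      exact mul_le_mul_of_nonneg_right (norm_le_pi_norm (h' - h) i) (abs_nonneg _)
  have hZcl : ∀ s, IsClosed (Z s) := by
    intro s
    refine IsClosed.inter (isClosed_Icc.preimage continuous_fst) (IsClosed.inter ?_
      (IsClosed.inter ?_ ((isClosed_coneOf g s).preimage (by fun_prop))))
    · have : {q : ℝ × E | q.2 ∈ halfspaces g (hh q.1)}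
          = ⋂ i, {q : ℝ × E | inner ℝ (g i) q.2 ≤ hh q.1 i} := by
        ext; simp [halfspaces]
      change IsClosed {q : ℝ × E | q.2 ∈ halfspaces g (hh q.1)}
      rw [this]
      exact isClosed_iInter fun i => isClosed_le (by fun_prop)
        ((continuous_apply i).comp (hhc.comp continuous_fst))
    · change IsClosed {q : ℝ × E | ∀ i ∈ s, inner ℝ (g i) q.2 = hh q.1 i}
      simp only [Set.ofPred_forall]
      exact isClosed_iInter fun i => isClosed_iInter fun _ => isClosed_eq (by fun_prop)
        ((continuous_apply i).comp (hhc.comp continuous_fst))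
  -- Compactness makes the time set of each piece closed, as the covering lemma requires.
  have hZcpt : ∀ s, IsCompact (Z s) := by
    intro s
    refine Metric.isCompact_of_isClosed_isBounded (hZcl s) ?_
    rcases (Z s).eq_empty_or_nonempty with he | ⟨q₀, hq₀⟩
    · rw [he]; exact Bornology.isBounded_empty
    · refine ((Metric.isBounded_Icc (0 : ℝ) 1).prod
        (Metric.isBounded_closedBall (x := q₀.2) (r := C * ‖h' - h‖ * 1))).subset ?_
      intro q hq
      refine ⟨hq.1, ?_⟩
      rw [Metric.mem_closedBall, dist_eq_norm]
      refine (hZL s q hq q₀ hq₀).trans (mul_le_mul_of_nonneg_left ?_ ?_)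
      · rw [abs_le]
        constructor <;> linarith [hq.1.1, hq.1.2, hq₀.1.1, hq₀.1.2]
      · exact mul_nonneg (Finset.sum_nonneg fun s _ => hK0 s) (norm_nonneg _)
  have hZVI : ∀ s, ∀ q ∈ Z s, ∀ v ∈ halfspaces g (hh q.1), inner ℝ (w - q.2) (v - q.2) ≤ 0 := by
    rintro s ⟨t, a⟩ ⟨-, -, hta, μ, hμ, hμa⟩ v hv
    simp only at hta hμa hv ⊢
    rw [hμa, sum_inner]
    refine Finset.sum_nonpos fun i hi => ?_
    rw [inner_smul_left, inner_sub_right, hta i hi]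
    exact mul_nonpos_of_nonneg_of_nonpos (hμ i) (sub_nonpos.2 (hv i))
  have hex : ∀ t ∈ Set.Icc (0 : ℝ) 1, ∃ a ∈ halfspaces g (hh t),
      ∀ v ∈ halfspaces g (hh t), inner ℝ (w - a) (v - a) ≤ 0 := by
    intro t ht
    -- The interpolation of `u` and `u'` is feasible for the interpolated right-hand side.
    have hne : (halfspaces g (hh t)).Nonempty := by
      refine ⟨u + t • (u' - u), fun i => ?_⟩
      have e1 := mul_le_mul_of_nonneg_left (hu i) (sub_nonneg.2 ht.2)
      have e2 := mul_le_mul_of_nonneg_left (hu' i) ht.1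
      rw [inner_add_right, inner_smul_right, inner_sub_right]
      simp only [hh, Pi.add_apply, Pi.smul_apply, Pi.sub_apply, smul_eq_mul]
      linarith
    obtain ⟨a, ha, hmin⟩ := exists_norm_eq_iInf_of_complete_convex hne
      (isClosed_halfspaces g _).isComplete (convex_halfspaces g _) w
    exact ⟨a, ha, (norm_eq_iInf_iff_real_inner_le_zero (convex_halfspaces g _) ha).1 hmin⟩
  choose! U hU hUVI using hex
  have h0 : U 0 = u := by
    have e : hh 0 = h := by simp [hh]
    have m : (0 : ℝ) ∈ Set.Icc (0 : ℝ) 1 := by simp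
    refine eq_of_inner_sub_le (w := w) (hU 0 m) (by rwa [e]) (hUVI 0 m) (by rwa [e])
  have h1 : U 1 = u' := by
    have e : hh 1 = h' := by simp [hh]
    have m : (1 : ℝ) ∈ Set.Icc (0 : ℝ) 1 := by simp
    refine eq_of_inner_sub_le (w := w) (hU 1 m) (by rwa [e]) (hUVI 1 m) (by rwa [e])
  have hfst : ∀ s, ∀ q ∈ Z s, q.2 = U q.1 := fun s q hq =>
    eq_of_inner_sub_le (w := w) hq.2.1 (hU q.1 hq.1) (hZVI s q hq) (hUVI q.1 hq.1)
  rw [← h0, ← h1]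
  refine norm_sub_le_of_finite_closed_cover U (fun s => Prod.fst '' Z s) _
    (fun s => ((hZcpt s).image continuous_fst).isClosed) ?_ ?_
  · intro t ht
    refine Set.mem_iUnion.2
      ⟨Finset.univ.filter fun i => inner ℝ (g i) (U t) = hh t i, (t, U t), ?_, rfl⟩
    refine ⟨ht, hU t ht, fun i hi => (Finset.mem_filter.1 hi).2, ?_⟩
    exact mem_coneOf_of_forall_inner_le g (hh t) (hU t ht) (hUVI t ht)
  · rintro s _ ⟨a, ha, rfl⟩ _ ⟨b, hb, rfl⟩
    rw [← hfst s a ha, ← hfst s b hb]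
    exact hZL s a ha b hb

end Polyhedral

/-! ### Singular value bounds, rows, and slices of the polyhedron -/

section Matrix

theorem inner_mulV {m n : ℕ} (A : Matrix (Fin m) (Fin n) ℝ) (x : Vec n) (y : Vec m) :
    inner ℝ (mulV A x) y = inner ℝ x (mulV A.transpose y) := by
  have h := Matrix.toEuclideanLin_conjTranspose_eq_adjoint A
  rw [Matrix.conjTranspose_eq_transpose_of_trivial] at h
  rw [mulV, mulV, h, LinearMap.adjoint_inner_right]

theorem sigmaMax_nonneg {m n : ℕ} (A : Matrix (Fin m) (Fin n) ℝ) : 0 ≤ sigmaMax A :=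
  LinearMap.singularValues_nonneg _ _

/-- In an eigenbasis of `AᵀA` the form `‖Ax‖²` is a weighted sum of squares whose weights are at
most the largest eigenvalue. -/
theorem norm_sq_mulV_le {m n : ℕ} (A : Matrix (Fin m) (Fin n) ℝ) (x : Vec n) :
    ‖mulV A x‖ ^ 2 ≤ sigmaMax A ^ 2 * ‖x‖ ^ 2 := by
  set T := Matrix.toEuclideanLin A with hT
  have hn : Module.finrank ℝ (Vec n) = n := by simp
  have hs := T.isSymmetric_adjoint_comp_self
  set e := hs.eigenvectorBasis hn with he
  have h1 : ‖mulV A x‖ ^ 2 = inner ℝ x ((LinearMap.adjoint T ∘ₗ T) x) := by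
    rw [LinearMap.comp_apply, LinearMap.adjoint_inner_right, real_inner_self_eq_norm_sq]
  rw [h1, ← e.sum_inner_mul_inner, ← e.sum_sq_norm_inner_right x, Finset.mul_sum]
  refine Finset.sum_le_sum fun i _ => ?_
  have h2 := hs.eigenvectorBasis_apply_self_apply hn x i
  rw [← he, e.repr_apply_apply, e.repr_apply_apply] at h2
  rw [h2, real_inner_comm]
  have h3 : hs.eigenvalues hn i ≤ sigmaMax A ^ 2 := by
    have hn0 : 0 < n := i.pos
    rw [sigmaMax, ← hT, T.sq_singularValues_of_lt hn hn0]
    exact hs.eigenvalues_antitone hn (Fin.mk_le_of_le_val (Nat.zero_le _))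
  have h4 : ‖inner ℝ (e i) x‖ ^ 2 = inner ℝ (e i) x * inner ℝ (e i) x := by
    rw [Real.norm_eq_abs, sq_abs, sq]
  rw [h4]
  have := mul_le_mul_of_nonneg_right h3 (mul_self_nonneg (inner ℝ (e i) x : ℝ))
  simp only [RCLike.ofReal_real_eq_id, id_eq] at *
  linarith

theorem norm_mulV_le {m n : ℕ} (A : Matrix (Fin m) (Fin n) ℝ) (x : Vec n) :
    ‖mulV A x‖ ≤ sigmaMax A * ‖x‖ := by
  refine le_of_sq_le_sq ?_ (mul_nonneg (sigmaMax_nonneg A) (norm_nonneg x))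
  rw [mul_pow]
  exact norm_sq_mulV_le A x

theorem norm_mulV_transpose_le {m n : ℕ} (A : Matrix (Fin m) (Fin n) ℝ) (y : Vec m) :
    ‖mulV A.transpose y‖ ≤ sigmaMax A * ‖y‖ := by
  rcases (norm_nonneg (mulV A.transpose y)).eq_or_lt with h0 | h0
  · rw [← h0]
    exact mul_nonneg (sigmaMax_nonneg A) (norm_nonneg y)
  · have h1 : ‖mulV A.transpose y‖ * ‖mulV A.transpose y‖
        ≤ (sigmaMax A * ‖y‖) * ‖mulV A.transpose y‖ := by
      rw [← real_inner_self_eq_norm_mul_norm, ← inner_mulV]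
      calc _ ≤ ‖mulV A (mulV A.transpose y)‖ * ‖y‖ := real_inner_le_norm _ _
        _ ≤ (sigmaMax A * ‖mulV A.transpose y‖) * ‖y‖ :=
          mul_le_mul_of_nonneg_right (norm_mulV_le A _) (norm_nonneg y)
        _ = _ := by ring
    exact le_of_mul_le_mul_right h1 h0

theorem continuous_mulV {m n : ℕ} (A : Matrix (Fin m) (Fin n) ℝ) : Continuous (mulV A) :=
  LinearMap.continuous_of_finiteDimensional _

/-- The rows of a matrix as Euclidean vectors. -/
def rowV {m n : ℕ} (M : Matrix (Fin m) (Fin n) ℝ) (i : Fin m) : Vec n := WithLp.toLp 2 (M i)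

theorem inner_rowV {m n : ℕ} (M : Matrix (Fin m) (Fin n) ℝ) (i : Fin m) (x : Vec n) :
    inner ℝ (rowV M i) x = mulV M x i := by
  simp [rowV, Matrix.toLpLin_apply, Matrix.mulVec, dotProduct, PiLp.inner_apply, mul_comm]

theorem mulV_transpose_eq_sum {m n : ℕ} (M : Matrix (Fin m) (Fin n) ℝ) (μ : Vec m) :
    mulV M.transpose μ = ∑ i, μ i • rowV M i := by
  ext j
  simp [rowV, Matrix.toLpLin_apply, Matrix.mulVec, dotProduct, mul_comm]

theorem polyhedron_eq_halfspaces {n l : ℕ} (G : Matrix (Fin l) (Fin n) ℝ) (h : Vec l) :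
    polyhedron G h = halfspaces (rowV G) (fun i => h i) := by
  ext x
  simp only [polyhedron, halfspaces, inner_rowV]

theorem isClosed_polyhedron {n l : ℕ} (G : Matrix (Fin l) (Fin n) ℝ) (h : Vec l) :
    IsClosed (polyhedron G h) := by
  rw [polyhedron_eq_halfspaces]
  exact isClosed_halfspaces _ _

theorem convex_polyhedron {n l : ℕ} (G : Matrix (Fin l) (Fin n) ℝ) (h : Vec l) :
    Convex ℝ (polyhedron G h) := by
  rw [polyhedron_eq_halfspaces]
  exact convex_halfspaces _ _

theorem isClosed_feasibleSet {n m l : ℕ} (A : Matrix (Fin m) (Fin n) ℝ) (b : Vec m)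
    (G : Matrix (Fin l) (Fin n) ℝ) (h : Vec l) : IsClosed (feasibleSet A b G h) :=
  (isClosed_polyhedron G h).inter (isClosed_eq (continuous_mulV A) continuous_const)

theorem convex_feasibleSet {n m l : ℕ} (A : Matrix (Fin m) (Fin n) ℝ) (b : Vec m)
    (G : Matrix (Fin l) (Fin n) ℝ) (h : Vec l) : Convex ℝ (feasibleSet A b G h) := by
  intro u hu v hv s t hs ht hst
  refine ⟨convex_polyhedron G h hu.1 hv.1 hs ht hst, ?_⟩
  rw [mulV, map_add, map_smul, map_smul]
  change s • mulV A u + t • mulV A v = b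
  rw [hu.2, hv.2, ← add_smul, hst, one_smul]

/-- Projections onto the slices `{u | G u ≤ h, A u = d}` are Lipschitz in `d`, with a constant
depending on `A` and `G` only. -/
theorem exists_lipschitz_slice_projection {n m l : ℕ} (A : Matrix (Fin m) (Fin n) ℝ)
    (G : Matrix (Fin l) (Fin n) ℝ) :
    ∃ C : ℝ, 0 ≤ C ∧ ∀ (h : Vec l) (d d' : Vec m) (w u u' : Vec n),
      u ∈ feasibleSet A d G h →
      (∀ v ∈ feasibleSet A d G h, inner ℝ (w - u) (v - u) ≤ 0) →
      u' ∈ feasibleSet A d' G h →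
      (∀ v ∈ feasibleSet A d' G h, inner ℝ (w - u') (v - u') ≤ 0) →
      ‖u' - u‖ ≤ C * ‖d' - d‖ := by
  -- The equation `Au = d` is a pair of inequalities with normals `±` the rows of `A`, so `h` and
  -- `d` enter only the right-hand side.
  obtain ⟨C, hC0, hC⟩ := exists_lipschitz_projection
    (Sum.elim (rowV G) (Sum.elim (rowV A) (fun i => - rowV A i)))
  refine ⟨C, hC0, fun h d d' w u u' hu huw hu' huw' => ?_⟩
  let H : Vec m → Fin l ⊕ (Fin m ⊕ Fin m) → ℝ := fun d =>
    Sum.elim (fun i => h i) (Sum.elim (fun i => d i) (fun i => - d i))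
  have hset : ∀ d, halfspaces (Sum.elim (rowV G) (Sum.elim (rowV A) (fun i => - rowV A i))) (H d)
      = feasibleSet A d G h := by
    intro d
    ext v
    simp only [halfspaces, feasibleSet, polyhedron, Set.mem_ofPred_eq, H, Sum.forall, Sum.elim_inl,
      Sum.elim_inr, inner_rowV, inner_neg_left, neg_le_neg_iff]
    refine and_congr_right fun _ => ⟨fun hv => ?_, fun hv => ?_⟩
    · ext i
      exact le_antisymm (hv.1 i) (hv.2 i)
    · rw [hv]
      exact ⟨fun _ => le_rfl, fun _ => le_rfl⟩
  have h1 := hC (H d) (H d') w u u' (by rwa [hset]) (by rwa [hset]) (by rwa [hset])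
    (by rwa [hset])
  refine h1.trans (mul_le_mul_of_nonneg_left ?_ hC0)
  rw [pi_norm_le_iff_of_nonneg (norm_nonneg _)]
  have h2 : ∀ i, |d' i - d i| ≤ ‖d' - d‖ := fun i => PiLp.norm_apply_le (d' - d) i
  rintro (i | i | i)
  · simp [H]
  · simpa [H] using h2 i
  · have := h2 i
    rw [abs_sub_comm] at this
    simpa [H, neg_add_eq_sub] using this

end Matrix

/-! ### Quadratic bounds, existence of minimizers, first-order conditions -/

section Smooth

/-- The quadratic bounds for a function whose gradient is Lipschitz on a convex set. -/
theorem abs_sub_sub_inner_gradient_le {n : ℕ} {f : Vec n → ℝ} {S : Set (Vec n)} {L : ℝ}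
    (hf : Differentiable ℝ f) (hS : Convex ℝ S)
    (hL : ∀ u ∈ S, ∀ u' ∈ S, ‖gradient f u - gradient f u'‖ ≤ L * ‖u - u'‖)
    {u v : Vec n} (hu : u ∈ S) (hv : v ∈ S) :
    |f v - f u - inner ℝ (gradient f u) (v - u)| ≤ L / 2 * ‖v - u‖ ^ 2 := by
  set d := v - u with hd
  let ψ : ℝ → ℝ := fun t => f (u + t • d) - f u - t * inner ℝ (gradient f u) d
  have hder : ∀ t, HasDerivAt ψ (inner ℝ (gradient f (u + t • d) - gradient f u) d) t := by
    intro t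
    have h1 : HasFDerivAt f (InnerProductSpace.toDual ℝ (Vec n) (gradient f (u + t • d)))
        (u + t • d) := (hf _).hasGradientAt.hasFDerivAt
    have h2 : HasDerivAt (fun t : ℝ => u + t • d) d t := by
      simpa using ((hasDerivAt_id t).smul_const d).const_add u
    have h3 := h1.comp_hasDerivAt t h2
    have h4 := (h3.sub_const (f u)).sub
      ((hasDerivAt_id t).mul_const (inner ℝ (gradient f u) d))
    refine h4.congr_deriv ?_
    simp [inner_sub_left]
  have key := image_norm_le_of_norm_deriv_right_le_deriv_boundary (f := ψ)
    (f' := fun t => inner ℝ (gradient f (u + t • d) - gradient f u) d) (a := 0) (b := 1)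
    (B := fun t => L / 2 * ‖d‖ ^ 2 * t ^ 2) (B' := fun t => L * ‖d‖ ^ 2 * t)
    (fun t _ => (hder t).continuousAt.continuousWithinAt)
    (fun t _ => (hder t).hasDerivWithinAt) (by simp [ψ])
    (fun t => by
      have := (hasDerivAt_pow 2 t).const_mul (L / 2 * ‖d‖ ^ 2)
      refine this.congr_deriv ?_
      norm_num
      ring)
    (fun t ht => by
      have hmem : u + t • d ∈ S := hS.add_smul_sub_mem hu hv ⟨ht.1, ht.2.le⟩
      calc _ ≤ ‖gradient f (u + t • d) - gradient f u‖ * ‖d‖ := norm_inner_le_norm _ _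
        _ ≤ (L * ‖u + t • d - u‖) * ‖d‖ :=
          mul_le_mul_of_nonneg_right (hL _ hmem _ hu) (norm_nonneg d)
        _ = L * ‖d‖ ^ 2 * t := by
          rw [add_sub_cancel_left, norm_smul, Real.norm_of_nonneg ht.1]
          ring)
    (Set.right_mem_Icc.2 zero_le_one)
  simpa [ψ, hd] using key

/-- A continuous function with quadratic growth attains its minimum on a closed set. -/
theorem exists_min_of_quadratic_growth {n : ℕ} {F : Vec n → ℝ} {S : Set (Vec n)} {q u₀ : Vec n}
    {γ : ℝ} (hF : Continuous F) (hS : IsClosed S) (hu₀ : u₀ ∈ S) (hγ : 0 < γ)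
    (hgrow : ∀ v ∈ S, F u₀ + inner ℝ q (v - u₀) + γ / 2 * ‖v - u₀‖ ^ 2 ≤ F v) :
    ∃ x ∈ S, ∀ v ∈ S, F x ≤ F v := by
  -- Beyond this radius the quadratic term outweighs the linear one, so values are at least `F u₀`.
  set R := 2 * ‖q‖ / γ with hR
  have hR0 : 0 ≤ R := by positivity
  obtain ⟨x, hx, hmin⟩ := ((isCompact_closedBall u₀ R).inter_left hS).exists_isMinOn
    ⟨u₀, hu₀, Metric.mem_closedBall_self hR0⟩ hF.continuousOn
  refine ⟨x, hx.1, fun v hv => ?_⟩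
  by_cases hvR : v ∈ Metric.closedBall u₀ R
  · exact hmin ⟨hv, hvR⟩
  · have h1 : F x ≤ F u₀ := hmin ⟨hu₀, Metric.mem_closedBall_self hR0⟩
    rw [Metric.mem_closedBall, dist_eq_norm, not_le, hR, div_lt_iff₀ hγ] at hvR
    have h2 := hgrow v hv
    have h3 : -(‖q‖ * ‖v - u₀‖) ≤ inner ℝ q (v - u₀) :=
      (abs_le.1 (abs_real_inner_le_norm q (v - u₀))).1
    nlinarith [norm_nonneg (v - u₀), norm_nonneg q]

/-- First-order optimality on a convex set. -/
theorem inner_gradient_nonneg_of_min {n : ℕ} {F : Vec n → ℝ} {S : Set (Vec n)} {x q : Vec n}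
    (hS : Convex ℝ S) (hq : HasGradientAt F q x) (hx : x ∈ S) (hmin : ∀ v ∈ S, F x ≤ F v)
    {v : Vec n} (hv : v ∈ S) : 0 ≤ inner ℝ q (v - x) := by
  have h1 : IsLocalMinOn F S x := IsMinOn.localize (isMinOn_iff.2 hmin)
  have := h1.hasFDerivWithinAt_nonneg hq.hasFDerivAt.hasFDerivWithinAt
    (sub_mem_posTangentConeAt_of_segment_subset (hS.segment_subset hx hv))
  simpa using this

theorem IsProjOn.inner_le {n : ℕ} {S : Set (Vec n)} (hS : Convex ℝ S) {v w : Vec n}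
    (hw : IsProjOn S v w) {u : Vec n} (hu : u ∈ S) : inner ℝ (v - w) (u - w) ≤ 0 := by
  have : Nonempty S := ⟨⟨w, hw.1⟩⟩
  refine (norm_eq_iInf_iff_real_inner_le_zero hS hw.1).1 ?_ u hu
  refine le_antisymm (le_ciInf fun a => hw.2 a a.2) ?_
  exact ciInf_le ⟨0, by rintro _ ⟨a, rfl⟩; exact norm_nonneg _⟩ (⟨w, hw.1⟩ : S)

end Smooth

/-! ### Expansion and curvature of the proximal augmented Lagrangian -/

section ProxLag

variable {n m l : ℕ}

/-- The gradient of the proximal augmented Lagrangian in its first argument. -/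
noncomputable def gradProxLag (f : Vec n → ℝ) (A : Matrix (Fin m) (Fin n) ℝ) (b : Vec m) (ρ p : ℝ)
    (x z : Vec n) (y : Vec m) : Vec n :=
  gradient f x + mulV A.transpose (y + ρ • (mulV A x - b)) + p • (x - z)

/-- Apart from `f`, everything is quadratic in `x`, so the expansion is exact once the remainder of
`f` is kept. The gradient and both curvature bounds are read off from it. -/
theorem proxLag_sub (f : Vec n → ℝ) (A : Matrix (Fin m) (Fin n) ℝ) (b : Vec m) (ρ p : ℝ)
    (x v z : Vec n) (y : Vec m) :
    proxLag f A b ρ p v z y = proxLag f A b ρ p x z y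
      + inner ℝ (gradProxLag f A b ρ p x z y) (v - x)
      + (f v - f x - inner ℝ (gradient f x) (v - x))
      + ρ / 2 * ‖mulV A (v - x)‖ ^ 2 + p / 2 * ‖v - x‖ ^ 2 := by
  have hA : mulV A v - b = (mulV A x - b) + mulV A (v - x) := by
    rw [mulV, mulV, mulV, map_sub]
    abel
  have hz : v - z = (x - z) + (v - x) := by abel
  unfold proxLag augLag gradProxLag
  rw [hA, hz, norm_add_sq_real, norm_add_sq_real, inner_add_left, inner_add_left,
    real_inner_comm (v - x) (mulV A.transpose _), ← inner_mulV, inner_add_right, inner_add_right,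
    inner_smul_right, inner_smul_left, real_inner_comm y,
    real_inner_comm (mulV A x - b) (mulV A (v - x))]
  simp only [conj_trivial]
  ring

theorem hasGradientAt_proxLag {f : Vec n → ℝ} (hf : Differentiable ℝ f)
    (A : Matrix (Fin m) (Fin n) ℝ) (b : Vec m) (ρ p : ℝ) (x z : Vec n) (y : Vec m) :
    HasGradientAt (fun u => proxLag f A b ρ p u z y) (gradProxLag f A b ρ p x z y) x := by
  rw [hasGradientAt_iff_hasFDerivAt]
  have h1 : HasFDerivAt f (InnerProductSpace.toDual ℝ (Vec n) (gradient f x)) x :=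
    (hf x).hasGradientAt.hasFDerivAt
  have hlin : ∀ q : Vec n, HasFDerivAt (fun v : Vec n => (inner ℝ q (v - x) : ℝ))
      (InnerProductSpace.toDual ℝ (Vec n) q) x := by
    intro q
    have := (InnerProductSpace.toDual ℝ (Vec n) q).hasFDerivAt (x := x)
    refine (this.sub_const (inner ℝ q x)).congr_of_eventuallyEq (Eventually.of_forall fun v => ?_)
    simp [inner_sub_right]
  have hsub : HasFDerivAt (fun v : Vec n => v - x) (ContinuousLinearMap.id ℝ (Vec n)) x :=
    (hasFDerivAt_id x).sub_const x
  have hA : HasFDerivAt (fun v : Vec n => mulV A (v - x))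
      ((LinearMap.toContinuousLinearMap (Matrix.toEuclideanLin A)).comp
        (ContinuousLinearMap.id ℝ (Vec n))) x :=
    (LinearMap.toContinuousLinearMap (Matrix.toEuclideanLin A)).hasFDerivAt.comp x hsub
  have h3 := ((((hlin (gradProxLag f A b ρ p x z y)).const_add (proxLag f A b ρ p x z y)).add
    ((h1.sub_const (f x)).sub (hlin (gradient f x)))).add
    (hA.norm_sq.const_mul (ρ / 2))).add (hsub.norm_sq.const_mul (p / 2))
  refine (h3.congr_of_eventuallyEq (Eventually.of_forall fun v => ?_)).congr_fderiv ?_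
  · exact proxLag_sub f A b ρ p x v z y
  · ext w
    simp

theorem continuous_proxLag {f : Vec n → ℝ} (hf : Differentiable ℝ f)
    (A : Matrix (Fin m) (Fin n) ℝ) (b : Vec m) (ρ p : ℝ) (z : Vec n) (y : Vec m) :
    Continuous (fun u => proxLag f A b ρ p u z y) :=
  continuous_iff_continuousAt.2 fun x => (hasGradientAt_proxLag hf A b ρ p x z y).continuousAt

/-- The objective defining `P(z)` is a case of `K`, so results on `K` apply to it. -/
theorem proxLag_zero (f : Vec n → ℝ) (A : Matrix (Fin m) (Fin n) ℝ) (b : Vec m) (p : ℝ)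
    (x z : Vec n) : proxLag f A b 0 p x z 0 = f x + p / 2 * ‖x - z‖ ^ 2 := by
  simp [proxLag, augLag]

theorem proxLag_of_mulV_eq (f : Vec n → ℝ) (A : Matrix (Fin m) (Fin n) ℝ) (b : Vec m) (ρ p : ℝ)
    (x z : Vec n) (y : Vec m) (hx : mulV A x = b) :
    proxLag f A b ρ p x z y = f x + p / 2 * ‖x - z‖ ^ 2 := by
  simp [proxLag, augLag, hx]

variable {f : Vec n → ℝ} {A : Matrix (Fin m) (Fin n) ℝ} {b : Vec m} {G : Matrix (Fin l) (Fin n) ℝ}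
  {h : Vec l} {Lf ρ p : ℝ}

/-- The prox term offsets the possible nonconvexity of `f`, leaving modulus `p - Lf`; the penalty
can only help. -/
theorem proxLag_lower (hf : Differentiable ℝ f)
    (hL : ∀ u ∈ polyhedron G h, ∀ u' ∈ polyhedron G h,
      ‖gradient f u - gradient f u'‖ ≤ Lf * ‖u - u'‖) (hρ : 0 ≤ ρ)
    (z : Vec n) (y : Vec m) {x v : Vec n} (hx : x ∈ polyhedron G h) (hv : v ∈ polyhedron G h) :
    proxLag f A b ρ p x z y + inner ℝ (gradProxLag f A b ρ p x z y) (v - x)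
      + (p - Lf) / 2 * ‖v - x‖ ^ 2 ≤ proxLag f A b ρ p v z y := by
  have h1 := (abs_le.1 (abs_sub_sub_inner_gradient_le hf (convex_polyhedron G h) hL hx hv)).1
  have h2 := proxLag_sub f A b ρ p x v z y
  have h3 : 0 ≤ ρ / 2 * ‖mulV A (v - x)‖ ^ 2 := by positivity
  linarith

theorem proxLag_upper (hf : Differentiable ℝ f)
    (hL : ∀ u ∈ polyhedron G h, ∀ u' ∈ polyhedron G h,
      ‖gradient f u - gradient f u'‖ ≤ Lf * ‖u - u'‖) (hρ : 0 ≤ ρ)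
    (z : Vec n) (y : Vec m) {x v : Vec n} (hx : x ∈ polyhedron G h) (hv : v ∈ polyhedron G h) :
    proxLag f A b ρ p v z y ≤ proxLag f A b ρ p x z y
      + inner ℝ (gradProxLag f A b ρ p x z y) (v - x)
      + (Lf + ρ * sigmaMax A ^ 2 + p) / 2 * ‖v - x‖ ^ 2 := by
  have h1 := (abs_le.1 (abs_sub_sub_inner_gradient_le hf (convex_polyhedron G h) hL hx hv)).2
  have h2 := proxLag_sub f A b ρ p x v z y
  have h3 := mul_le_mul_of_nonneg_left (norm_sq_mulV_le A (v - x)) (div_nonneg hρ zero_le_two)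
  linarith

end ProxLag

/-! ### Primal and dual error bounds -/

section ErrorBounds

variable {n m l : ℕ} {f : Vec n → ℝ} {A : Matrix (Fin m) (Fin n) ℝ} {b : Vec m}
  {G : Matrix (Fin l) (Fin n) ℝ} {h : Vec l} {Lf ρ p : ℝ}

theorem exists_dualFn_eq (hf : Differentiable ℝ f)
    (hL : ∀ u ∈ polyhedron G h, ∀ u' ∈ polyhedron G h,
      ‖gradient f u - gradient f u'‖ ≤ Lf * ‖u - u'‖) (hρ : 0 ≤ ρ) (hp : Lf < p)
    (hne : (polyhedron G h).Nonempty) (y : Vec m) (z : Vec n) :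
    ∃ X ∈ polyhedron G h, dualFn f A b G h ρ p y z = proxLag f A b ρ p X z y ∧
      (∀ u ∈ polyhedron G h, dualFn f A b G h ρ p y z ≤ proxLag f A b ρ p u z y) ∧
      ∀ u ∈ polyhedron G h, 0 ≤ inner ℝ (gradProxLag f A b ρ p X z y) (u - X) := by
  obtain ⟨u₀, hu₀⟩ := hne
  obtain ⟨X, hX, hmin⟩ := exists_min_of_quadratic_growth
    (continuous_proxLag hf A b ρ p z y) (isClosed_polyhedron G h) hu₀ (sub_pos.2 hp)
    (fun v hv => proxLag_lower hf hL hρ z y hu₀ hv)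
  have heq : dualFn f A b G h ρ p y z = proxLag f A b ρ p X z y :=
    IsLeast.csInf_eq ⟨⟨X, hX, rfl⟩, by rintro _ ⟨u, hu, rfl⟩; exact hmin u hu⟩
  refine ⟨X, hX, heq, fun u hu => heq ▸ hmin u hu, fun u hu => ?_⟩
  exact inner_gradient_nonneg_of_min (convex_polyhedron G h)
    (hasGradientAt_proxLag hf A b ρ p X z y) hX hmin hu

theorem exists_proxFn_eq (hf : Differentiable ℝ f)
    (hL : ∀ u ∈ polyhedron G h, ∀ u' ∈ polyhedron G h,
      ‖gradient f u - gradient f u'‖ ≤ Lf * ‖u - u'‖) (hp : Lf < p)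
    (hne : (feasibleSet A b G h).Nonempty) (z : Vec n) :
    ∃ X ∈ feasibleSet A b G h, proxFn f A b G h p z = f X + p / 2 * ‖X - z‖ ^ 2 ∧
      (∀ u ∈ feasibleSet A b G h, proxFn f A b G h p z ≤ f u + p / 2 * ‖u - z‖ ^ 2) ∧
      ∀ u ∈ feasibleSet A b G h, 0 ≤ inner ℝ (gradient f X + p • (X - z)) (u - X) := by
  obtain ⟨u₀, hu₀⟩ := hne
  obtain ⟨X, hX, hmin⟩ := exists_min_of_quadratic_growth
    (continuous_proxLag hf A b 0 p z 0) (isClosed_feasibleSet A b G h) hu₀ (sub_pos.2 hp)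
    (fun v hv => proxLag_lower hf hL le_rfl z 0 hu₀.1 hv.1)
  have hmin' := hmin
  simp only [proxLag_zero] at hmin'
  have heq : proxFn f A b G h p z = f X + p / 2 * ‖X - z‖ ^ 2 :=
    IsLeast.csInf_eq ⟨⟨X, hX, rfl⟩, by rintro _ ⟨u, hu, rfl⟩; exact hmin' u hu⟩
  refine ⟨X, hX, heq, fun u hu => heq ▸ hmin' u hu, fun u hu => ?_⟩
  have := inner_gradient_nonneg_of_min (convex_feasibleSet A b G h)
    (hasGradientAt_proxLag hf A b 0 p X z 0) hX hmin hu
  simpa [gradProxLag] using this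

theorem gradProxLag_monotone (hf : Differentiable ℝ f)
    (hL : ∀ u ∈ polyhedron G h, ∀ u' ∈ polyhedron G h,
      ‖gradient f u - gradient f u'‖ ≤ Lf * ‖u - u'‖) (hρ : 0 ≤ ρ)
    (z : Vec n) (y : Vec m) {u v : Vec n} (hu : u ∈ polyhedron G h) (hv : v ∈ polyhedron G h) :
    (p - Lf) * ‖u - v‖ ^ 2 ≤
      inner ℝ (gradProxLag f A b ρ p u z y - gradProxLag f A b ρ p v z y) (u - v) := by
  have h1 := proxLag_lower (A := A) (b := b) (p := p) hf hL hρ z y hu hv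
  have h2 := proxLag_lower (A := A) (b := b) (p := p) hf hL hρ z y hv hu
  rw [← neg_sub u v, inner_neg_right, norm_neg] at h1
  rw [inner_sub_left]
  linarith

theorem norm_gradProxLag_sub_le
    (hL : ∀ u ∈ polyhedron G h, ∀ u' ∈ polyhedron G h,
      ‖gradient f u - gradient f u'‖ ≤ Lf * ‖u - u'‖) (hρ : 0 ≤ ρ) (hp : 0 ≤ p)
    (z : Vec n) (y : Vec m) {u v : Vec n} (hu : u ∈ polyhedron G h) (hv : v ∈ polyhedron G h) :
    ‖gradProxLag f A b ρ p u z y - gradProxLag f A b ρ p v z y‖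
      ≤ (Lf + ρ * sigmaMax A ^ 2 + p) * ‖u - v‖ := by
  have heq : gradProxLag f A b ρ p u z y - gradProxLag f A b ρ p v z y
      = (gradient f u - gradient f v) + ρ • mulV A.transpose (mulV A (u - v)) + p • (u - v) := by
    simp only [gradProxLag, mulV, map_add, map_smul, map_sub, smul_sub]
    abel
  rw [heq]
  have h1 : ‖ρ • mulV A.transpose (mulV A (u - v))‖ ≤ ρ * sigmaMax A ^ 2 * ‖u - v‖ := by
    rw [norm_smul, Real.norm_of_nonneg hρ, mul_assoc]
    refine mul_le_mul_of_nonneg_left ?_ hρ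
    calc _ ≤ sigmaMax A * ‖mulV A (u - v)‖ := norm_mulV_transpose_le A _
      _ ≤ sigmaMax A * (sigmaMax A * ‖u - v‖) :=
        mul_le_mul_of_nonneg_left (norm_mulV_le A _) (sigmaMax_nonneg A)
      _ = _ := by ring
  have h2 : ‖p • (u - v)‖ = p * ‖u - v‖ := by rw [norm_smul, Real.norm_of_nonneg hp]
  have h3 := norm_add₃_le (a := gradient f u - gradient f v)
    (b := ρ • mulV A.transpose (mulV A (u - v))) (c := p • (u - v))
  have h4 := hL u hu v hv
  linarith

/-- The projected gradient step measures the distance to the minimizer. -/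
theorem norm_sub_minimizer_le (hf : Differentiable ℝ f)
    (hL : ∀ u ∈ polyhedron G h, ∀ u' ∈ polyhedron G h,
      ‖gradient f u - gradient f u'‖ ≤ Lf * ‖u - u'‖) (hρ : 0 ≤ ρ) (hp : 0 ≤ p)
    {c : ℝ} (hc : 0 < c) {z : Vec n} {y : Vec m} {x x' X : Vec n} (hx : x ∈ polyhedron G h)
    (hx' : x' ∈ polyhedron G h) (hX : X ∈ polyhedron G h)
    (hproj : ∀ u ∈ polyhedron G h, inner ℝ (x - c • gradProxLag f A b ρ p x z y - x') (u - x') ≤ 0)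
    (hXVI : ∀ u ∈ polyhedron G h, 0 ≤ inner ℝ (gradProxLag f A b ρ p X z y) (u - X)) :
    c * (p - Lf) * ‖x' - X‖ ≤ (1 + c * (Lf + ρ * sigmaMax A ^ 2 + p)) * ‖x - x'‖ := by
  have h1 := hproj X hX
  have h2 := mul_nonneg hc.le (hXVI x' hx')
  have h3 := mul_le_mul_of_nonneg_left
    (gradProxLag_monotone (A := A) (b := b) (p := p) hf hL hρ z y hx' hX) hc.le
  set g := gradProxLag f A b ρ p x z y
  set g' := gradProxLag f A b ρ p x' z y
  set gX := gradProxLag f A b ρ p X z y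
  -- The first two terms on the right are nonpositive, by the projection inequality at `X` and the
  -- optimality of `X` at `x'`; Cauchy–Schwarz handles the third.
  have h4 : c * inner ℝ (g' - gX) (x' - X)
      = inner ℝ (x - c • g - x') (X - x') - c * inner ℝ gX (x' - X)
        + inner ℝ ((x - x') - c • (g - g')) (x' - X) := by
    rw [← neg_sub x' X]
    simp only [inner_sub_left, inner_neg_right, inner_smul_left, smul_sub, conj_trivial]
    ring
  have h5 : inner ℝ ((x - x') - c • (g - g')) (x' - X)
      ≤ ((1 + c * (Lf + ρ * sigmaMax A ^ 2 + p)) * ‖x - x'‖) * ‖x' - X‖ := by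
    refine (real_inner_le_norm _ _).trans (mul_le_mul_of_nonneg_right ?_ (norm_nonneg _))
    refine (norm_sub_le _ _).trans ?_
    rw [norm_smul, Real.norm_of_nonneg hc.le]
    have := mul_le_mul_of_nonneg_left
      (norm_gradProxLag_sub_le (A := A) (b := b) hL hρ hp z y hx hx') hc.le
    linarith
  rcases (norm_nonneg (x' - X)).eq_or_lt with h0 | h0
  · rw [← h0, mul_zero]
    have : (0 : ℝ) ≤ ‖g - g'‖ := norm_nonneg _
    have h6 := norm_gradProxLag_sub_le (A := A) (b := b) hL hρ hp z y hx hx'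
    have h7 := mul_nonneg hc.le (this.trans h6)
    linarith [norm_nonneg (x - x')]
  · refine le_of_mul_le_mul_right ?_ h0
    calc _ = c * ((p - Lf) * ‖x' - X‖ ^ 2) := by ring
      _ ≤ _ := by linarith

/-- The minimizers of the proximal augmented Lagrangian are Lipschitz in the prox center. -/
theorem norm_minimizer_sub_le (hf : Differentiable ℝ f)
    (hL : ∀ u ∈ polyhedron G h, ∀ u' ∈ polyhedron G h,
      ‖gradient f u - gradient f u'‖ ≤ Lf * ‖u - u'‖) (hρ : 0 ≤ ρ) (hp : 0 ≤ p)
    {z z' : Vec n} {y : Vec m} {X X' : Vec n}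
    (hX : X ∈ polyhedron G h) (hX' : X' ∈ polyhedron G h)
    (hXVI : ∀ u ∈ polyhedron G h, 0 ≤ inner ℝ (gradProxLag f A b ρ p X z y) (u - X))
    (hXVI' : ∀ u ∈ polyhedron G h, 0 ≤ inner ℝ (gradProxLag f A b ρ p X' z' y) (u - X')) :
    (p - Lf) * ‖X - X'‖ ≤ p * ‖z - z'‖ := by
  have h1 := hXVI X' hX'
  have h2 := hXVI' X hX
  have h3 := gradProxLag_monotone (A := A) (b := b) (p := p) hf hL hρ z y hX hX'
  have heq : gradProxLag f A b ρ p X' z' y = gradProxLag f A b ρ p X' z y + p • (z - z') := by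
    simp only [gradProxLag, smul_sub]
    abel
  rw [heq, inner_add_left, inner_smul_left] at h2
  rw [← neg_sub X X', inner_neg_right] at h1
  rw [inner_sub_left] at h3
  simp only [conj_trivial] at h2
  have h4 := mul_le_mul_of_nonneg_left (real_inner_le_norm (z - z') (X - X')) hp
  rcases (norm_nonneg (X - X')).eq_or_lt with h0 | h0
  · rw [← h0, mul_zero]
    positivity
  · refine le_of_mul_le_mul_right ?_ h0
    calc _ = (p - Lf) * ‖X - X'‖ ^ 2 := by ring
      _ ≤ _ := by linarith

/-- Projections are nonexpansive. -/
theorem norm_projection_sub_le {S : Set (Vec n)} {w w' u u' : Vec n} (hu : u ∈ S) (hu' : u' ∈ S)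
    (hw : ∀ v ∈ S, inner ℝ (w - u) (v - u) ≤ 0)
    (hw' : ∀ v ∈ S, inner ℝ (w' - u') (v - u') ≤ 0) : ‖u - u'‖ ≤ ‖w - w'‖ := by
  have h1 := hw u' hu'
  have h2 := hw' u hu
  have h3 : inner ℝ (u - u') (u - u') = inner ℝ (w - u) (u' - u) + inner ℝ (w' - u') (u - u')
      + inner ℝ (w - w') (u - u') := by
    rw [← neg_sub u u', inner_neg_right, ← inner_neg_left, ← inner_add_left, ← inner_add_left]
    congr 1
    abel
  have h4 := real_inner_le_norm (w - w') (u - u')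
  rw [real_inner_self_eq_norm_mul_norm] at h3
  rcases (norm_nonneg (u - u')).eq_or_lt with h0 | h0
  · rw [← h0]
    exact norm_nonneg _
  · exact le_of_mul_le_mul_right (by linarith) h0

/-- The global dual error bound, relative to a Lipschitz constant `C` of the projections onto the
slices `{u | G u ≤ h, A u = d}`. -/
theorem norm_minimizer_sub_prox_le
    (hL : ∀ u ∈ polyhedron G h, ∀ u' ∈ polyhedron G h,
      ‖gradient f u - gradient f u'‖ ≤ Lf * ‖u - u'‖) (hp : 0 < p) {C : ℝ}
    (hC : ∀ (d d' : Vec m) (w u u' : Vec n), u ∈ feasibleSet A d G h →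
      (∀ v ∈ feasibleSet A d G h, inner ℝ (w - u) (v - u) ≤ 0) →
      u' ∈ feasibleSet A d' G h →
      (∀ v ∈ feasibleSet A d' G h, inner ℝ (w - u') (v - u') ≤ 0) →
      ‖u' - u‖ ≤ C * ‖d' - d‖)
    {z : Vec n} {y : Vec m} {X Y : Vec n} (hX : X ∈ polyhedron G h)
    (hXVI : ∀ u ∈ polyhedron G h, 0 ≤ inner ℝ (gradProxLag f A b ρ p X z y) (u - X))
    (hY : Y ∈ feasibleSet A b G h)
    (hYVI : ∀ u ∈ feasibleSet A b G h, 0 ≤ inner ℝ (gradient f Y + p • (Y - z)) (u - Y)) :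
    (p - Lf) * ‖X - Y‖ ≤ p * C * ‖mulV A X - b‖ := by
  -- Recasts first-order optimality as: `u` is the projection of `z - q / p`.
  have key : ∀ q u v : Vec n, 0 ≤ inner ℝ (q + p • (u - z)) (v - u) →
      inner ℝ (z - p⁻¹ • q - u) (v - u) ≤ 0 := by
    intro q u v hv
    have : q + p • (u - z) = (-p) • (z - p⁻¹ • q - u) := by
      simp only [neg_smul, smul_sub, smul_inv_smul₀ hp.ne']
      abel
    rw [this, inner_smul_left] at hv
    simp only [conj_trivial] at hv
    nlinarith
  have hXm : X ∈ feasibleSet A (mulV A X) G h := ⟨hX, rfl⟩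
  -- Within the slice through `X`, directions lie in the kernel of `A`, so the multiplier and
  -- penalty terms disappear.
  have hX1 : ∀ v ∈ feasibleSet A (mulV A X) G h,
      inner ℝ (z - p⁻¹ • gradient f X - X) (v - X) ≤ 0 := by
    intro v hv
    apply key
    have h1 := hXVI v hv.1
    have h2 : mulV A (v - X) = 0 := by
      have := hv.2
      rw [mulV, map_sub]
      exact sub_eq_zero.2 this
    have h3 : inner ℝ (mulV A.transpose (y + ρ • (mulV A X - b))) (v - X) = (0 : ℝ) := by
      rw [real_inner_comm, ← inner_mulV, h2, inner_zero_left]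
    rw [gradProxLag, inner_add_left, inner_add_left, h3] at h1
    rw [inner_add_left]
    linarith
  have hY1 : ∀ v ∈ feasibleSet A b G h,
      inner ℝ (z - p⁻¹ • gradient f Y - Y) (v - Y) ≤ 0 := fun v hv => key _ _ _ (hYVI v hv)
  -- `W` splits `X - Y` into a change of slice, costing `C‖AX - b‖`, and a change of projected
  -- point, costing `(Lf/p)‖X - Y‖`, which is absorbed on the left.
  obtain ⟨W, hW, hWmin⟩ := exists_norm_eq_iInf_of_complete_convex ⟨Y, hY⟩
    (isClosed_feasibleSet A b G h).isComplete (convex_feasibleSet A b G h)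
    (z - p⁻¹ • gradient f X)
  have hW1 := (norm_eq_iInf_iff_real_inner_le_zero (convex_feasibleSet A b G h) hW).1 hWmin
  have h1 := hC b (mulV A X) _ W X hW hW1 hXm hX1
  have h2 := norm_projection_sub_le hW hY hW1 hY1
  have h3 : ‖z - p⁻¹ • gradient f X - (z - p⁻¹ • gradient f Y)‖ ≤ p⁻¹ * (Lf * ‖X - Y‖) := by
    have : z - p⁻¹ • gradient f X - (z - p⁻¹ • gradient f Y)
        = - (p⁻¹ • (gradient f X - gradient f Y)) := by
      rw [smul_sub]; abel
    rw [this, norm_neg, norm_smul, Real.norm_of_nonneg (inv_nonneg.2 hp.le)]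
    exact mul_le_mul_of_nonneg_left (hL X hX Y hY.1) (inv_nonneg.2 hp.le)
  have h4 := norm_sub_le_norm_sub_add_norm_sub X W Y
  have h5 : ‖X - Y‖ ≤ C * ‖mulV A X - b‖ + p⁻¹ * (Lf * ‖X - Y‖) := by linarith
  have h6 := mul_le_mul_of_nonneg_left h5 hp.le
  rw [mul_add, mul_inv_cancel_left₀ hp.ne'] at h6
  linarith

end ErrorBounds

/-! ### Descent of the potential and stationarity of one step -/

section Descent

variable {n m l : ℕ} {f : Vec n → ℝ} {A : Matrix (Fin m) (Fin n) ℝ} {b : Vec m}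
  {G : Matrix (Fin l) (Fin n) ℝ} {h : Vec l} {Lf ρ p : ℝ}

theorem proxLag_add_dual (f : Vec n → ℝ) (A : Matrix (Fin m) (Fin n) ℝ) (b : Vec m) (ρ p : ℝ)
    (x z : Vec n) (y w : Vec m) :
    proxLag f A b ρ p x z (y + w) = proxLag f A b ρ p x z y + inner ℝ w (mulV A x - b) := by
  unfold proxLag augLag
  rw [inner_add_left]
  ring

theorem norm_sub_add_smul_sq (u z δ : Vec n) (β : ℝ) :
    ‖u - (z + β • δ)‖ ^ 2 = ‖u - z‖ ^ 2 - 2 * β * inner ℝ δ (u - z) + β ^ 2 * ‖δ‖ ^ 2 := by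
  rw [← sub_sub, norm_sub_sq_real, inner_smul_right, norm_smul, mul_pow, Real.norm_eq_abs, sq_abs,
    real_inner_comm]
  ring

theorem proxLag_add_center (f : Vec n → ℝ) (A : Matrix (Fin m) (Fin n) ℝ) (b : Vec m) (ρ p : ℝ)
    (x z δ : Vec n) (β : ℝ) (y : Vec m) :
    proxLag f A b ρ p x (z + β • δ) y = proxLag f A b ρ p x z y
      + p / 2 * (β ^ 2 * ‖δ‖ ^ 2 - 2 * β * inner ℝ δ (x - z)) := by
  unfold proxLag
  rw [norm_sub_add_smul_sq]
  ring

/-- The potential is `(K - d) + (P - d) + P`. Both brackets are nonnegative, the second because `K`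
agrees with the proximal objective on the feasible set. -/
theorem lt_potential (hf : Differentiable ℝ f)
    (hL : ∀ u ∈ polyhedron G h, ∀ u' ∈ polyhedron G h,
      ‖gradient f u - gradient f u'‖ ≤ Lf * ‖u - u'‖) (hρ : 0 ≤ ρ) (hp0 : 0 ≤ p) (hp : Lf < p)
    (hne : (feasibleSet A b G h).Nonempty) {flow : ℝ}
    (hflow : ∀ u ∈ feasibleSet A b G h, flow < f u) {x : Vec n} (hx : x ∈ polyhedron G h)
    (y : Vec m) (z : Vec n) : flow < potential f A b G h ρ p x y z := by
  obtain ⟨X, -, -, hd, -⟩ := exists_dualFn_eq (A := A) (b := b) hf hL hρ hp ⟨x, hx⟩ y z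
  obtain ⟨Y, hY, hPY, -, -⟩ := exists_proxFn_eq hf hL hp hne z
  have h1 := hd x hx
  have h2 := hd Y hY.1
  rw [proxLag_of_mulV_eq _ _ _ _ _ _ _ _ hY.2, ← hPY] at h2
  have h3 := hflow Y hY
  have h4 : 0 ≤ p / 2 * ‖Y - z‖ ^ 2 := by positivity
  unfold potential
  linarith

/-- One iteration decreases the potential. -/
theorem potential_step (hf : Differentiable ℝ f)
    (hL : ∀ u ∈ polyhedron G h, ∀ u' ∈ polyhedron G h,
      ‖gradient f u - gradient f u'‖ ≤ Lf * ‖u - u'‖) (hρ : 0 ≤ ρ) (hp0 : 0 < p) (hp : Lf < p)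
    (hne : (feasibleSet A b G h).Nonempty) {C : ℝ}
    (hC : ∀ (d d' : Vec m) (w u u' : Vec n), u ∈ feasibleSet A d G h →
      (∀ v ∈ feasibleSet A d G h, inner ℝ (w - u) (v - u) ≤ 0) →
      u' ∈ feasibleSet A d' G h →
      (∀ v ∈ feasibleSet A d' G h, inner ℝ (w - u') (v - u') ≤ 0) →
      ‖u' - u‖ ≤ C * ‖d' - d‖)
    {c α β σ σ₁ τ : ℝ} (hc : 0 < c) (hcL : Lf + ρ * sigmaMax A ^ 2 + p ≤ 1 / c)
    (hα : 0 < α) (hβ : 0 < β)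
    (hσ : 1 + c * (Lf + ρ * sigmaMax A ^ 2 + p) ≤ σ * (c * (p - Lf)))
    (hσ₁ : p ≤ σ₁ * (p - Lf)) (hτ : p * C ≤ τ * (p - Lf))
    (hασ : α * (sigmaMax A ^ 2 * (1 + σ) ^ 2) ≤ 1 / (8 * c))
    (hβ1 : β ≤ 1) (hβσ : 16 * σ₁ * β ≤ 1) (hβτ : 8 * p * τ ^ 2 * β ≤ α)
    {x x' z : Vec n} {y : Vec m} (hx : x ∈ polyhedron G h) (hx' : x' ∈ polyhedron G h)
    (hproj : ∀ u ∈ polyhedron G h, inner ℝ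
      (x - c • gradProxLag f A b ρ p x z (y + α • (mulV A x - b)) - x') (u - x') ≤ 0) :
    ∃ X : Vec n, ‖x' - X‖ ≤ σ * ‖x - x'‖ ∧
      potential f A b G h ρ p x' (y + α • (mulV A x - b)) (z + β • (x' - z))
        + (3 / (8 * c) * ‖x - x'‖ ^ 2 + p * β / 8 * ‖x' - z‖ ^ 2 + α / 2 * ‖mulV A X - b‖ ^ 2)
      ≤ potential f A b G h ρ p x y z := by
  set y' := y + α • (mulV A x - b) with hy'
  set z' := z + β • (x' - z) with hz'
  have hγ : 0 < p - Lf := sub_pos.2 hp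
  have hneP : (polyhedron G h).Nonempty := ⟨x, hx⟩
  obtain ⟨X₀, -, -, hd, -⟩ := exists_dualFn_eq (A := A) (b := b) hf hL hρ hp hneP y z
  obtain ⟨X, hX, hdX, hd1, hXVI⟩ := exists_dualFn_eq (A := A) (b := b) hf hL hρ hp hneP y' z
  obtain ⟨X', hX', hdX', -, hXVI'⟩ := exists_dualFn_eq (A := A) (b := b) hf hL hρ hp hneP y' z'
  obtain ⟨Y, hY, hPY, -, hYVI⟩ := exists_proxFn_eq hf hL hp hne z
  obtain ⟨Y', -, -, hP', -⟩ := exists_proxFn_eq hf hL hp hne z'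
  have hxX : ‖x' - X‖ ≤ σ * ‖x - x'‖ := by
    have h1 := norm_sub_minimizer_le hf hL hρ hp0.le hc hx hx' hX hproj hXVI
    have h2 := mul_le_mul_of_nonneg_right hσ (norm_nonneg (x - x'))
    have h3 : 0 < c * (p - Lf) := mul_pos hc hγ
    refine le_of_mul_le_mul_left ?_ h3
    linarith
  refine ⟨X, hxX, ?_⟩
  set a := ‖x - x'‖ with ha
  set e := ‖x' - z‖ with he
  set r := ‖mulV A X - b‖ with hr
  have ha0 : 0 ≤ a := norm_nonneg _
  have he0 : 0 ≤ e := norm_nonneg _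
  have hr0 : 0 ≤ r := norm_nonneg _
  have e1 : proxLag f A b ρ p x z y' = proxLag f A b ρ p x z y + α * ‖mulV A x - b‖ ^ 2 := by
    rw [hy', proxLag_add_dual, inner_smul_left, real_inner_self_eq_norm_sq]
    simp
  have e2 : proxLag f A b ρ p x' z y' ≤ proxLag f A b ρ p x z y' - 1 / (2 * c) * a ^ 2 := by
    have h1 := proxLag_upper (A := A) (b := b) (p := p) hf hL hρ z y' hx hx'
    have h2 := hproj x hx
    have h3 : x - c • gradProxLag f A b ρ p x z y' - x'
        = (x - x') - c • gradProxLag f A b ρ p x z y' := by abel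
    rw [h3, inner_sub_left, inner_smul_left, real_inner_self_eq_norm_sq] at h2
    simp only [conj_trivial] at h2
    rw [← neg_sub x x', inner_neg_right, norm_neg] at h1
    have h4 : 1 / c * a ^ 2 ≤ inner ℝ (gradProxLag f A b ρ p x z y') (x - x') := by
      rw [one_div, inv_mul_le_iff₀ hc]
      linarith
    have h5 := mul_le_mul_of_nonneg_right hcL (sq_nonneg a)
    have h6 : 1 / (2 * c) * a ^ 2 = (1 / c * a ^ 2) / 2 := by
      field_simp
    linarith
  have e3 : proxLag f A b ρ p x' z' y' = proxLag f A b ρ p x' z y'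
      + p / 2 * (β ^ 2 * e ^ 2 - 2 * β * e ^ 2) := by
    rw [hz', proxLag_add_center, real_inner_self_eq_norm_sq]
  -- The minimizer `X` for the new multiplier is a competitor for the old one.
  have e4 : dualFn f A b G h ρ p y z + α * inner ℝ (mulV A x - b) (mulV A X - b)
      ≤ dualFn f A b G h ρ p y' z := by
    have h1 := hd X hX
    rw [hdX, hy', proxLag_add_dual, inner_smul_left]
    simp only [conj_trivial]
    linarith
  have e5 : dualFn f A b G h ρ p y' z
      + p / 2 * (β ^ 2 * e ^ 2 - 2 * β * inner ℝ (x' - z) (X' - z))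
      ≤ dualFn f A b G h ρ p y' z' := by
    have h1 := hd1 X' hX'
    rw [hdX', hz', proxLag_add_center]
    linarith
  have e6 : proxFn f A b G h p z' ≤ proxFn f A b G h p z
      + p / 2 * (β ^ 2 * e ^ 2 - 2 * β * inner ℝ (x' - z) (Y - z)) := by
    have h1 := hP' Y hY
    rw [hz', norm_sub_add_smul_sq] at h1
    rw [hPY]
    linarith
  have e7 : inner ℝ (x' - z) (X' - z) - inner ℝ (x' - z) (Y - z) ≤ e * (σ₁ * β * e + τ * r) := by
    rw [← inner_sub_right, sub_sub_sub_cancel_right]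
    refine (real_inner_le_norm _ _).trans (mul_le_mul_of_nonneg_left ?_ he0)
    have h1 : ‖X - X'‖ ≤ σ₁ * β * e := by
      have h2 := norm_minimizer_sub_le hf hL hρ hp0.le hX hX' hXVI hXVI'
      have h3 : ‖z - z'‖ = β * e := by
        rw [hz', sub_add_cancel_left, norm_neg, norm_smul, Real.norm_of_nonneg hβ.le]
      rw [h3] at h2
      have h4 := mul_le_mul_of_nonneg_right hσ₁ (mul_nonneg hβ.le he0)
      refine le_of_mul_le_mul_left ?_ hγ
      linarith
    have h2 : ‖X - Y‖ ≤ τ * r := by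
      have h3 := norm_minimizer_sub_prox_le hL hp0 hC hX hXVI hY hYVI
      have h4 := mul_le_mul_of_nonneg_right hτ hr0
      refine le_of_mul_le_mul_left ?_ hγ
      linarith
    have h3 := norm_sub_le_norm_sub_add_norm_sub X' X Y
    rw [norm_sub_rev X' X] at h3
    linarith
  -- The left side equals `α‖A(x - X)‖² - α‖AX - b‖²`; the factor 2 on `d` in the potential makes
  -- this square complete.
  have e8 : α * ‖mulV A x - b‖ ^ 2 - 2 * α * inner ℝ (mulV A x - b) (mulV A X - b)
      ≤ 1 / (8 * c) * a ^ 2 - α * r ^ 2 := by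
    have h1 := norm_sub_sq_real (mulV A x - b) (mulV A X - b)
    have h2 : mulV A x - b - (mulV A X - b) = mulV A (x - X) := by
      rw [sub_sub_sub_cancel_right, mulV, mulV, mulV, map_sub]
    rw [h2] at h1
    have h3 : ‖x - X‖ ≤ (1 + σ) * a := by
      have := norm_sub_le_norm_sub_add_norm_sub x x' X
      linarith
    have h4 : ‖mulV A (x - X)‖ ^ 2 ≤ sigmaMax A ^ 2 * ((1 + σ) * a) ^ 2 :=
      (norm_sq_mulV_le A (x - X)).trans (mul_le_mul_of_nonneg_left
        (pow_le_pow_left₀ (norm_nonneg _) h3 2) (sq_nonneg _))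
    have h5 := mul_le_mul_of_nonneg_left h4 hα.le
    have h6 := mul_le_mul_of_nonneg_right hασ (sq_nonneg a)
    rw [h1] at h5
    linarith
  -- The `σ₁` term costs `pβe²/8`. Young's inequality splits the `τ` term into `pβe²/4` and `4pβτ²r²
  -- ≤ αr²/2`.
  have e9 : 2 * p * β * (e * (σ₁ * β * e + τ * r))
      ≤ 3 * (p * β) / 8 * e ^ 2 + α / 2 * r ^ 2 := by
    have hpβ : 0 < p * β := mul_pos hp0 hβ
    have h1 := mul_le_mul_of_nonneg_right hβσ (mul_nonneg hpβ.le (sq_nonneg e))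
    have h2 := mul_le_mul_of_nonneg_right hβτ (sq_nonneg r)
    have h3 := mul_nonneg hpβ.le (sq_nonneg (e / 2 - 2 * τ * r))
    linarith
  have e10 := mul_le_mul_of_nonneg_left e7 (by positivity : 0 ≤ 2 * p * β)
  have e11 : p * β ^ 2 * e ^ 2 ≤ p * β * e ^ 2 := by
    have := mul_le_mul_of_nonneg_left hβ1 (by positivity : 0 ≤ p * β * e ^ 2)
    linarith
  have e12 : 3 / (8 * c) * a ^ 2 + 1 / (8 * c) * a ^ 2 = 1 / (2 * c) * a ^ 2 := by
    field_simp
    ring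
  unfold potential
  linarith

/-- One iteration produces an approximately stationary point. -/
theorem isEpsStationary_step
    (hL : ∀ u ∈ polyhedron G h, ∀ u' ∈ polyhedron G h,
      ‖gradient f u - gradient f u'‖ ≤ Lf * ‖u - u'‖) (hρ : 0 ≤ ρ) (hp : 0 ≤ p)
    {c σ ε : ℝ} (hc : 0 < c) {x x' z X : Vec n} {y : Vec m}
    (hx : x ∈ polyhedron G h) (hx' : x' ∈ polyhedron G h)
    (hproj : ∀ u ∈ polyhedron G h,
      inner ℝ (x - c • gradProxLag f A b ρ p x z y - x') (u - x') ≤ 0)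
    (hX : ‖x' - X‖ ≤ σ * ‖x - x'‖)
    (h1 : sigmaMax A * σ * ‖x - x'‖ + ‖mulV A X - b‖ ≤ ε)
    (h2 : (Lf + c⁻¹ + p + ρ * sigmaMax A ^ 2 * (1 + σ)) * ‖x - x'‖ + p * ‖x' - z‖
      + ρ * sigmaMax A * ‖mulV A X - b‖ ≤ ε) :
    IsEpsStationary f A b G h ε x' y := by
  have hs := sigmaMax_nonneg A
  have hdec : ∀ u, mulV A u - b = mulV A (u - X) + (mulV A X - b) := by
    intro u
    rw [mulV, mulV, mulV, map_sub]
    abel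
  constructor
  · rw [hdec x']
    refine (norm_add_le _ _).trans (le_trans ?_ h1)
    have := (norm_mulV_le A (x' - X)).trans (mul_le_mul_of_nonneg_left hX hs)
    linarith
  · set g := gradProxLag f A b ρ p x z y with hg
    -- The scaled residual of the projection is normal to the polyhedron at `x'`, hence a
    -- subgradient of the indicator.
    refine ⟨c⁻¹ • (x - c • g - x'), ⟨by simp [indicatorFn, hx'], fun u => ?_⟩, ?_⟩
    · by_cases hu : u ∈ polyhedron G h
      · have := mul_nonpos_of_nonneg_of_nonpos (inv_nonneg.2 hc.le) (hproj u hu)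
        simp only [indicatorFn, hx', hu, if_true, zero_add]
        rw [inner_smul_left]
        exact_mod_cast this
      · simp [indicatorFn, hu]
    · have heq : gradient f x' + mulV A.transpose y + c⁻¹ • (x - c • g - x')
          = ((gradient f x' - gradient f x) + c⁻¹ • (x - x'))
            - (p • ((x - x') + (x' - z)) + ρ • mulV A.transpose (mulV A x - b)) := by
        simp only [hg, gradProxLag, mulV, map_add, map_smul, map_sub, smul_sub, smul_add,
          inv_smul_smul₀ hc.ne']
        abel
      rw [heq]
      have n1 := hL x' hx' x hx
      rw [norm_sub_rev x' x] at n1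
      have n2 : ‖c⁻¹ • (x - x')‖ = c⁻¹ * ‖x - x'‖ := by
        rw [norm_smul, Real.norm_of_nonneg (inv_nonneg.2 hc.le)]
      have n3 : ‖p • ((x - x') + (x' - z))‖ ≤ p * (‖x - x'‖ + ‖x' - z‖) := by
        rw [norm_smul, Real.norm_of_nonneg hp]
        exact mul_le_mul_of_nonneg_left (norm_add_le _ _) hp
      have n4 : ‖mulV A x - b‖ ≤ sigmaMax A * ((1 + σ) * ‖x - x'‖) + ‖mulV A X - b‖ := by
        rw [hdec x]
        refine (norm_add_le _ _).trans (add_le_add_left ?_ _)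
        refine (norm_mulV_le A _).trans (mul_le_mul_of_nonneg_left ?_ hs)
        have := norm_sub_le_norm_sub_add_norm_sub x x' X
        linarith
      have n5 : ‖ρ • mulV A.transpose (mulV A x - b)‖
          ≤ ρ * (sigmaMax A * (sigmaMax A * ((1 + σ) * ‖x - x'‖) + ‖mulV A X - b‖)) := by
        rw [norm_smul, Real.norm_of_nonneg hρ]
        exact mul_le_mul_of_nonneg_left ((norm_mulV_transpose_le A _).trans
          (mul_le_mul_of_nonneg_left n4 hs)) hρ
      have t1 := norm_sub_le ((gradient f x' - gradient f x) + c⁻¹ • (x - x'))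
        (p • ((x - x') + (x' - z)) + ρ • mulV A.transpose (mulV A x - b))
      have t2 := norm_add_le (gradient f x' - gradient f x) (c⁻¹ • (x - x'))
      have t3 := norm_add_le (p • ((x - x') + (x' - z))) (ρ • mulV A.transpose (mulV A x - b))
      linarith

theorem IsEpsStationary.mem {ε : ℝ} {x : Vec n} {y : Vec m}
    (hxy : IsEpsStationary f A b G h ε x y) : x ∈ polyhedron G h := by
  obtain ⟨-, w, hw, -⟩ := hxy
  by_contra hx
  exact hw.1 (by simp [indicatorFn, hx])

theorem IsEpsStationary.mono {ε ε' : ℝ} {x : Vec n} {y : Vec m}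
    (hxy : IsEpsStationary f A b G h ε x y) (hε : ε ≤ ε') : IsEpsStationary f A b G h ε' x y := by
  obtain ⟨h1, w, hw, h2⟩ := hxy
  exact ⟨h1.trans hε, w, hw, h2.trans hε⟩

theorem inner_le_of_mem_subdiff_indicatorFn {S : Set (Vec n)} {x w : Vec n} (hx : x ∈ S)
    (hw : w ∈ subdiff (indicatorFn S) x) {u : Vec n} (hu : u ∈ S) : inner ℝ w (u - x) ≤ 0 := by
  have := hw.2 u
  simp only [indicatorFn, hx, hu, if_true, zero_add] at this
  exact_mod_cast this

/-- A point of the polyhedron satisfying the variational inequality has multipliers. -/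
theorem isKKTPoint_of_inner_nonneg {x : Vec n} {y : Vec m} (hx : x ∈ polyhedron G h)
    (hAx : mulV A x = b)
    (hVI : ∀ u ∈ polyhedron G h, 0 ≤ inner ℝ (gradient f x + mulV A.transpose y) (u - x)) :
    IsKKTPoint f A b G h x y := by
  classical
  have hx1 := hx
  simp only [polyhedron_eq_halfspaces] at hx1 hVI
  obtain ⟨μ, hμ, hsum⟩ := mem_coneOf_of_forall_inner_le (rowV G) (fun i => h i)
    (q := -(gradient f x + mulV A.transpose y)) hx1 (fun v hv => by
      rw [inner_neg_left]
      linarith [hVI v hv])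
  -- Multipliers are set to zero off the active set, which gives complementarity.
  refine ⟨WithLp.toLp 2 fun i => if inner ℝ (rowV G i) x = h i then μ i else 0, ?_,
    sub_eq_zero.2 hAx, hx, fun i => ?_, fun i => ?_⟩
  · rw [mulV_transpose_eq_sum G]
    simp only [ite_smul, zero_smul]
    rw [← Finset.sum_filter, ← hsum, add_neg_cancel]
  · by_cases hi : inner ℝ (rowV G i) x = h i <;> simp [hi, hμ i]
  · by_cases hi : inner ℝ (rowV G i) x = h i
    · rw [← inner_rowV, hi, sub_self, mul_zero]
    · simp [hi]

/-- Limits of asymptotically stationary points are KKT points. -/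
theorem isKKTPoint_of_tendsto
    (hL : ∀ u ∈ polyhedron G h, ∀ u' ∈ polyhedron G h,
      ‖gradient f u - gradient f u'‖ ≤ Lf * ‖u - u'‖)
    {x : ℕ → Vec n} {y : ℕ → Vec m} {ε : ℕ → ℝ} {xbar : Vec n} {ybar : Vec m}
    (hx : Tendsto x atTop (𝓝 xbar)) (hy : Tendsto y atTop (𝓝 ybar)) (hε : Tendsto ε atTop (𝓝 0))
    (hst : ∀ t, IsEpsStationary f A b G h (ε t) (x t) (y t)) :
    IsKKTPoint f A b G h xbar ybar := by
  have hxP : ∀ t, x t ∈ polyhedron G h := fun t => (hst t).mem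
  have hbar : xbar ∈ polyhedron G h :=
    (isClosed_polyhedron G h).mem_of_tendsto hx (Eventually.of_forall hxP)
  choose hres w hw hwε using hst
  have hAx : mulV A xbar = b := by
    have h1 : Tendsto (fun t => mulV A (x t) - b) atTop (𝓝 (mulV A xbar - b)) :=
      (((continuous_mulV A).tendsto xbar).comp hx).sub_const b
    have h2 := squeeze_zero_norm hres hε
    exact sub_eq_zero.1 (tendsto_nhds_unique h1 h2)
  -- Only the Lipschitz bound on the polyhedron is available; it contains the iterates and their
  -- limit.
  have hgrad : Tendsto (fun t => gradient f (x t)) atTop (𝓝 (gradient f xbar)) := by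
    rw [tendsto_iff_norm_sub_tendsto_zero] at hx ⊢
    refine squeeze_zero (fun _ => norm_nonneg _) (fun t => hL _ (hxP t) _ hbar) ?_
    simpa using hx.const_mul Lf
  have hAy := ((continuous_mulV A.transpose).tendsto ybar).comp hy
  have hv := squeeze_zero_norm hwε hε
  refine isKKTPoint_of_inner_nonneg hbar hAx fun u hu => ?_
  have hlim : Tendsto (fun t => inner ℝ ((gradient f (x t) + mulV A.transpose (y t))
      - (gradient f (x t) + mulV A.transpose (y t) + w t)) (u - x t)) atTop
      (𝓝 (inner ℝ ((gradient f xbar + mulV A.transpose ybar) - 0) (u - xbar))) :=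
    ((hgrad.add hAy).sub hv).inner (tendsto_const_nhds.sub hx)
  rw [sub_zero] at hlim
  refine ge_of_tendsto' hlim fun t => ?_
  have := inner_le_of_mem_subdiff_indicatorFn (hxP t) (hw t) hu
  rw [sub_add_cancel_left, inner_neg_left]
  linarith

end Descent

/-! ### Choice of step sizes, summation and rates -/

section Convergence

variable {n m l : ℕ} {f : Vec n → ℝ} {A : Matrix (Fin m) (Fin n) ℝ} {b : Vec m}
  {G : Matrix (Fin l) (Fin n) ℝ} {h : Vec l} {Lf ρ p c α β : ℝ}
  {x : ℕ → Vec n} {y : ℕ → Vec m} {z : ℕ → Vec n}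

theorem IsSProxALM.mem (hs : IsSProxALM f A b G h ρ p c α β x y z) (t : ℕ) :
    x (t + 1) ∈ polyhedron G h := (hs.x_step t).1

/-- The starting point may lie outside the polyhedron, where no Lipschitz bound holds; the estimates
then apply from `x 1` on. -/
theorem IsSProxALM.shift (hs : IsSProxALM f A b G h ρ p c α β x y z) :
    IsSProxALM f A b G h ρ p c α β (fun t => x (t + 1)) (fun t => y (t + 1))
      (fun t => z (t + 1)) :=
  ⟨fun t => hs.y_step (t + 1), fun t => hs.x_step (t + 1), fun t => hs.z_step (t + 1)⟩

theorem IsSProxALM.inner_le (hs : IsSProxALM f A b G h ρ p c α β x y z)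
    (hf : Differentiable ℝ f) (t : ℕ) {u : Vec n} (hu : u ∈ polyhedron G h) :
    inner ℝ (x t - c • gradProxLag f A b ρ p (x t) (z t) (y (t + 1)) - x (t + 1))
      (u - x (t + 1)) ≤ 0 := by
  have h1 := (hs.x_step t).inner_le (convex_polyhedron G h) hu
  rwa [(hasGradientAt_proxLag hf A b ρ p (x t) (z t) (y (t + 1))).gradient] at h1

/-- For small step sizes, every iteration from a point of the polyhedron yields a stationarity
residual that is controlled by the decrease of the potential. -/
theorem exists_step_sizes (A : Matrix (Fin m) (Fin n) ℝ) (G : Matrix (Fin l) (Fin n) ℝ)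
    (hLf : 0 ≤ Lf) (hp : Lf < p) (hρ : 0 ≤ ρ) (hc : 0 < c)
    (hc' : c < 1 / (Lf + ρ * sigmaMax A ^ 2 + p)) :
    ∃ α' > 0, ∃ θ > 0, ∀ α β : ℝ, 0 < α → α < α' → 0 < β → β < θ * α →
      ∃ κ > 0, ∀ (b : Vec m) (h : Vec l) (f : Vec n → ℝ), Differentiable ℝ f →
        (∀ u ∈ polyhedron G h, ∀ u' ∈ polyhedron G h,
          ‖gradient f u - gradient f u'‖ ≤ Lf * ‖u - u'‖) →
        (feasibleSet A b G h).Nonempty →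
        ∀ (x : ℕ → Vec n) (y : ℕ → Vec m) (z : ℕ → Vec n),
          IsSProxALM f A b G h ρ p c α β x y z → ∀ t, x t ∈ polyhedron G h →
          ∃ ε : ℝ, 0 ≤ ε ∧
            ε ^ 2 ≤ κ * (potential f A b G h ρ p (x t) (y t) (z t)
              - potential f A b G h ρ p (x (t + 1)) (y (t + 1)) (z (t + 1))) ∧
            IsEpsStationary f A b G h ε (x (t + 1)) (y (t + 1)) := by
  obtain ⟨C, hC0, hC⟩ := exists_lipschitz_slice_projection A G
  have hs := sigmaMax_nonneg A
  have hp0 : 0 < p := hLf.trans_lt hp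
  have hγ : 0 < p - Lf := sub_pos.2 hp
  set s := sigmaMax A with hsdef
  have hLK : 0 < Lf + ρ * s ^ 2 + p := by positivity
  have hcL : Lf + ρ * s ^ 2 + p ≤ 1 / c := by
    rw [lt_div_iff₀ hLK] at hc'
    rw [le_div_iff₀ hc]
    linarith
  have hcγ : 0 < c * (p - Lf) := mul_pos hc hγ
  obtain ⟨σ, hσ0, hσ⟩ : ∃ σ : ℝ, 0 ≤ σ ∧
      1 + c * (Lf + ρ * s ^ 2 + p) = σ * (c * (p - Lf)) :=
    ⟨_, by positivity, (div_mul_cancel₀ _ hcγ.ne').symm⟩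
  obtain ⟨σ₁, hσ₁0, hσ₁⟩ : ∃ σ₁ : ℝ, 0 ≤ σ₁ ∧ p = σ₁ * (p - Lf) :=
    ⟨_, by positivity, (div_mul_cancel₀ _ hγ.ne').symm⟩
  obtain ⟨τ, hτ⟩ : ∃ τ : ℝ, p * C = τ * (p - Lf) := ⟨_, (div_mul_cancel₀ _ hγ.ne').symm⟩
  obtain ⟨α', hα'0, hα'⟩ : ∃ α' : ℝ, 0 < α' ∧ α' = 1 / (8 * c * (s ^ 2 * (1 + σ) ^ 2 + 1)) :=
    ⟨_, by positivity, rfl⟩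
  -- The first bound yields `8pτ²β ≤ α`. The second, with `α < α'`, yields `β(16σ₁ + 1) ≤ 1`, which
  -- covers both `β ≤ 1` and `16σ₁β ≤ 1`.
  obtain ⟨θ, hθ0, hθ1, hθ2⟩ : ∃ θ : ℝ, 0 < θ ∧ θ ≤ 1 / (8 * p * τ ^ 2 + 1) ∧
      θ ≤ 1 / (α' * (16 * σ₁ + 1)) :=
    ⟨_, lt_min (by positivity) (by positivity), min_le_left _ _, min_le_right _ _⟩
  refine ⟨α', hα'0, θ, hθ0, fun α β hα hαlt hβ hβlt => ?_⟩
  have hασ : α * (s ^ 2 * (1 + σ) ^ 2) ≤ 1 / (8 * c) := by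
    rw [hα', lt_div_iff₀ (by positivity)] at hαlt
    rw [le_div_iff₀ (by positivity)]
    have : 0 ≤ α * (8 * c) := by positivity
    linarith
  have hβ16 : β * (16 * σ₁ + 1) ≤ 1 := by
    have h1 : β < 1 / (α' * (16 * σ₁ + 1)) * α' := hβlt.trans_le
      (mul_le_mul hθ2 hαlt.le hα.le (by positivity))
    have h2 : 1 / (α' * (16 * σ₁ + 1)) * α' = 1 / (16 * σ₁ + 1) := by
      field_simp
    rw [h2, lt_div_iff₀ (by positivity)] at h1
    exact h1.le
  have hβ1 : β ≤ 1 := by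
    have : 0 ≤ β * (16 * σ₁) := by positivity
    linarith
  have hβτ : 8 * p * τ ^ 2 * β ≤ α := by
    have h1 : β < 1 / (8 * p * τ ^ 2 + 1) * α := hβlt.trans_le
      (mul_le_mul_of_nonneg_right hθ1 hα.le)
    rw [one_div, ← div_eq_inv_mul, lt_div_iff₀ (by positivity)] at h1
    linarith
  have p1 : 0 ≤ s * σ := by positivity
  have p2 : 0 ≤ Lf + c⁻¹ + p + ρ * s ^ 2 * (1 + σ) := by positivity
  have p3 : 0 ≤ ρ * s := by positivity
  obtain ⟨M, hM⟩ : ∃ M : ℝ, M = 1 + s * σ + (Lf + c⁻¹ + p + ρ * s ^ 2 * (1 + σ)) + p + ρ * s :=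
    ⟨_, rfl⟩
  have hM0 : 0 < M := by linarith
  obtain ⟨δ, hδ0, hδ1, hδ2, hδ3⟩ : ∃ δ : ℝ, 0 < δ ∧ δ ≤ 3 / (8 * c) ∧ δ ≤ p * β / 8 ∧ δ ≤ α / 2 :=
    ⟨min (3 / (8 * c)) (min (p * β / 8) (α / 2)),
      lt_min (by positivity) (lt_min (by positivity) (by positivity)), min_le_left _ _,
      (min_le_right _ _).trans (min_le_left _ _), (min_le_right _ _).trans (min_le_right _ _)⟩
  -- `M` dominates every coefficient of the residual, `δ` is at most every coefficient of the
  -- decrease, and 3 comes from `(a + e + r)² ≤ 3(a² + e² + r²)`.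
  refine ⟨3 * M ^ 2 / δ, by positivity, ?_⟩
  intro b h f hf hL hne x y z hseq t hxt
  have hproj := fun u hu => hseq.inner_le hf t (u := u) hu
  have hproj' := hproj
  rw [hseq.y_step t] at hproj'
  obtain ⟨X, hX, hdesc⟩ := potential_step hf hL hρ hp0 hp hne (hC h) hc hcL hα hβ
    (σ := σ) (σ₁ := σ₁) (τ := τ)
    hσ.le hσ₁.le hτ.le hασ hβ1 (by linarith) hβτ
    hxt (hseq.mem t) hproj'
  rw [← hseq.y_step t, ← hseq.z_step t] at hdesc
  set a := ‖x t - x (t + 1)‖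
  set e := ‖x (t + 1) - z t‖
  set r := ‖mulV A X - b‖
  have ha : 0 ≤ a := norm_nonneg _
  have he : 0 ≤ e := norm_nonneg _
  have hr : 0 ≤ r := norm_nonneg _
  refine ⟨M * (a + e + r), by positivity, ?_, ?_⟩
  · have d1 : δ * a ^ 2 ≤ 3 / (8 * c) * a ^ 2 :=
      mul_le_mul_of_nonneg_right hδ1 (sq_nonneg a)
    have d2 : δ * e ^ 2 ≤ p * β / 8 * e ^ 2 :=
      mul_le_mul_of_nonneg_right hδ2 (sq_nonneg e)
    have d3 : δ * r ^ 2 ≤ α / 2 * r ^ 2 :=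
      mul_le_mul_of_nonneg_right hδ3 (sq_nonneg r)
    have d4 : (a + e + r) ^ 2 ≤ 3 * (a ^ 2 + e ^ 2 + r ^ 2) := by
      linarith [sq_nonneg (a - e), sq_nonneg (a - r), sq_nonneg (e - r)]
    have d5 : δ * (a ^ 2 + e ^ 2 + r ^ 2) ≤ potential f A b G h ρ p (x t) (y t) (z t)
        - potential f A b G h ρ p (x (t + 1)) (y (t + 1)) (z (t + 1)) := by linarith
    calc (M * (a + e + r)) ^ 2 = M ^ 2 * (a + e + r) ^ 2 := by ring
      _ ≤ M ^ 2 * (3 * (a ^ 2 + e ^ 2 + r ^ 2)) := mul_le_mul_of_nonneg_left d4 (sq_nonneg M)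
      _ = 3 * M ^ 2 / δ * (δ * (a ^ 2 + e ^ 2 + r ^ 2)) := by field_simp
      _ ≤ _ := mul_le_mul_of_nonneg_left d5 (by positivity)
  · refine isEpsStationary_step hL hρ hp0.le hc hxt (hseq.mem t) hproj hX ?_ ?_
    · have c1 := mul_le_mul_of_nonneg_right (by linarith : s * σ ≤ M) ha
      have c2 := mul_le_mul_of_nonneg_right (by linarith : 1 ≤ M) hr
      have c3 := mul_nonneg hM0.le he
      linarith
    · have c1 := mul_le_mul_of_nonneg_right
        (by linarith : Lf + c⁻¹ + p + ρ * s ^ 2 * (1 + σ) ≤ M) ha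
      have c2 := mul_le_mul_of_nonneg_right (by linarith : p ≤ M) he
      have c3 := mul_le_mul_of_nonneg_right (by linarith : ρ * s ≤ M) hr
      linarith

theorem sum_sq_le_of_step {Φ ε : ℕ → ℝ} {κ flow : ℝ} (hκ : 0 < κ) (hΦ : ∀ t, flow < Φ t)
    (hε : ∀ t, ε t ^ 2 ≤ κ * (Φ t - Φ (t + 1))) (t : ℕ) :
    ∑ s ∈ Finset.range t, ε s ^ 2 ≤ κ * (Φ 0 - flow) := by
  calc _ ≤ ∑ s ∈ Finset.range t, κ * (Φ s - Φ (s + 1)) := Finset.sum_le_sum fun s _ => hε s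
    _ = κ * (Φ 0 - Φ t) := by rw [← Finset.mul_sum, Finset.sum_range_sub']
    _ ≤ _ := mul_le_mul_of_nonneg_left (by linarith [hΦ t]) hκ.le

theorem exists_le_sqrt_div_sqrt {ε : ℕ → ℝ} {B : ℝ}
    (hsum : ∀ t, ∑ s ∈ Finset.range t, ε s ^ 2 ≤ B) {t : ℕ} (ht : 0 < t) :
    ∃ s < t, ε s ≤ √B / √(t : ℝ) := by
  have ht' : (0 : ℝ) < t := Nat.cast_pos.2 ht
  obtain ⟨s, hs, hle⟩ := Finset.exists_le_of_sum_le (s := Finset.range t)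
    (f := fun s => ε s ^ 2) (g := fun _ => B / t) ⟨0, Finset.mem_range.2 ht⟩ (by
      rw [Finset.sum_const, Finset.card_range, nsmul_eq_mul, mul_div_cancel₀ _ ht'.ne']
      exact hsum t)
  refine ⟨s, Finset.mem_range.1 hs, ?_⟩
  rw [← Real.sqrt_div' B ht'.le]
  exact Real.le_sqrt_of_sq_le hle

theorem tendsto_zero_of_sum_sq_le {ε : ℕ → ℝ} {B : ℝ}
    (hsum : ∀ t, ∑ s ∈ Finset.range t, ε s ^ 2 ≤ B) : Tendsto ε atTop (𝓝 0) := by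
  have h1 := (summable_of_sum_range_le (fun s => sq_nonneg (ε s)) hsum).tendsto_atTop_zero
  have h2 := h1.sqrt
  simp only [Real.sqrt_sq_eq_abs, Real.sqrt_zero] at h2
  exact (tendsto_zero_iff_abs_tendsto_zero ε).2 h2

/-- Zero is a subgradient of the indicator, so some finite residual exists. This serves `x 1` when
`x 0` is outside the polyhedron. -/
theorem exists_isEpsStationary (f : Vec n → ℝ) (A : Matrix (Fin m) (Fin n) ℝ) (b : Vec m)
    {x : Vec n} (hx : x ∈ polyhedron G h) (y : Vec m) :
    ∃ ε : ℝ, 0 ≤ ε ∧ IsEpsStationary f A b G h ε x y := by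
  refine ⟨‖mulV A x - b‖ + ‖gradient f x + mulV A.transpose y + 0‖, by positivity,
    le_add_of_nonneg_right (norm_nonneg _), 0, ⟨by simp [indicatorFn, hx], fun u => ?_⟩,
    le_add_of_nonneg_left (norm_nonneg _)⟩
  by_cases hu : u ∈ polyhedron G h <;> simp [indicatorFn, hx, hu]

theorem exists_lt_div_sq_of_rate {B : ℝ} (hB : 0 < B)
    (hrate : ∀ t : ℕ, 0 < t → ∃ s < t,
      IsEpsStationary f A b G h (√B / √(t : ℝ)) (x (s + 1)) (y (s + 1))) {ε : ℝ} (hε : 0 < ε) :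
    ∃ s : ℕ, (s : ℝ) < B / ε ^ 2 ∧ IsEpsStationary f A b G h ε (x (s + 1)) (y (s + 1)) := by
  have hq : 0 < B / ε ^ 2 := by positivity
  have ht : 0 < ⌈B / ε ^ 2⌉₊ := Nat.ceil_pos.2 hq
  obtain ⟨s, hs, hst⟩ := hrate _ ht
  refine ⟨s, Nat.lt_ceil.1 hs, hst.mono ?_⟩
  have ht' : (0 : ℝ) < (⌈B / ε ^ 2⌉₊ : ℝ) := Nat.cast_pos.2 ht
  rw [← Real.sqrt_div' B ht'.le]
  refine Real.sqrt_le_iff.2 ⟨hε.le, ?_⟩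
  rw [div_le_iff₀ ht', mul_comm, ← div_le_iff₀ (by positivity)]
  exact Nat.le_ceil _

theorem isKKTPoint_of_mapClusterPt
    (hL : ∀ u ∈ polyhedron G h, ∀ u' ∈ polyhedron G h,
      ‖gradient f u - gradient f u'‖ ≤ Lf * ‖u - u'‖) {ε : ℕ → ℝ} (hε : Tendsto ε atTop (𝓝 0))
    (k : ℕ) (hst : ∀ t, IsEpsStationary f A b G h (ε t) (x (t + k)) (y (t + k)))
    {xbar : Vec n} {ybar : Vec m}
    (hcl : MapClusterPt (xbar, ybar) atTop (fun t => (x t, y t))) :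
    IsKKTPoint f A b G h xbar ybar := by
  obtain ⟨ψ, hψ, hlim⟩ := MapClusterPt.tendsto_subseq hcl
  have hadd : Tendsto (fun t : ℕ => t + k) atTop atTop := tendsto_add_atTop_nat k
  -- Starting the subsequence at `k` prevents truncation in `ψ (t + k) - k`.
  have hψk : ∀ t, k ≤ ψ (t + k) := fun t => (Nat.le_add_left k t).trans (hψ.le_apply)
  have hlim' := hlim.comp hadd
  refine isKKTPoint_of_tendsto hL (x := fun t => x (ψ (t + k))) (y := fun t => y (ψ (t + k)))
    (ε := fun t => ε (ψ (t + k) - k)) hlim'.fst_nhds hlim'.snd_nhds ?_ fun t => ?_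
  · exact hε.comp ((tendsto_sub_atTop_nat k).comp (hψ.tendsto_atTop.comp hadd))
  · have := hst (ψ (t + k) - k)
    rwa [Nat.sub_add_cancel (hψk t)] at this

end Convergence

end SProxALM

/-! ### Limit points and iteration complexity -/

theorem theorem2p4 {n m l : ℕ}
    (A : Matrix (Fin m) (Fin n) ℝ) (G : Matrix (Fin l) (Fin n) ℝ)
    (Lf p ρ c : ℝ) (hLf : 0 ≤ Lf) (hpLf : Lf < p) (hp : 3 * Lf ≤ p) (hρ : 0 ≤ ρ)
    (hc : 0 < c) (hc' : c < 1 / (Lf + ρ * SProxALM.sigmaMax A ^ 2 + p)) :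
    -- thresholds depending only on `Lf, A, G, p, ρ, c`: `α < α'` and `β < β' = θ * α`
    ∃ α' > 0, ∃ θ > 0, ∀ α β : ℝ, 0 < α → α < α' → 0 < β → β < θ * α →
      -- `κ` depends only on `p, ρ, c, α, β, Lf, A, G`
      ∃ κ > 0, ∀ (b : SProxALM.Vec m) (h : SProxALM.Vec l) (f : SProxALM.Vec n → ℝ) (flow : ℝ),
        Differentiable ℝ f →
        (∀ u ∈ SProxALM.polyhedron G h, ∀ u' ∈ SProxALM.polyhedron G h,
          ‖gradient f u - gradient f u'‖ ≤ Lf * ‖u - u'‖) →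
        (SProxALM.feasibleSet A b G h).Nonempty →
        (∀ u ∈ SProxALM.feasibleSet A b G h, flow < f u) →
        ∀ (x : ℕ → SProxALM.Vec n) (y : ℕ → SProxALM.Vec m) (z : ℕ → SProxALM.Vec n),
          SProxALM.IsSProxALM f A b G h ρ p c α β x y z →
          (∀ (xbar : SProxALM.Vec n) (ybar : SProxALM.Vec m),
            MapClusterPt (xbar, ybar) atTop (fun t => (x t, y t)) →
            SProxALM.IsKKTPoint f A b G h xbar ybar) ∧
          (∃ B > 0,
            (x 0 ∈ SProxALM.polyhedron G h →
              B = κ * (SProxALM.potential f A b G h ρ p (x 0) (y 0) (z 0) - flow)) ∧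
            (∀ t : ℕ, 0 < t → ∃ s < t,
              SProxALM.IsEpsStationary f A b G h (√B / √(t : ℝ)) (x (s + 1)) (y (s + 1))) ∧
            (∀ ε : ℝ, 0 < ε → ∃ s : ℕ, (s : ℝ) < B / ε ^ 2 ∧
              SProxALM.IsEpsStationary f A b G h ε (x (s + 1)) (y (s + 1)))) := by
  obtain ⟨α', hα', θ, hθ, hstep⟩ :=
    SProxALM.exists_step_sizes A G hLf hpLf hρ hc hc'
  refine ⟨α', hα', θ, hθ, fun α β hα hαlt hβ hβlt => ?_⟩
  obtain ⟨κ, hκ, hstep⟩ := hstep α β hα hαlt hβ hβlt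
  refine ⟨κ, hκ, fun b h f flow hf hL hne hflow x y z hs => ?_⟩
  have hp0 : 0 ≤ p := hLf.trans hpLf.le
  have hlow : ∀ u ∈ SProxALM.polyhedron G h, ∀ y z,
      flow < SProxALM.potential f A b G h ρ p u y z := fun u hu y z =>
    SProxALM.lt_potential hf hL hρ hp0 hpLf hne hflow hu y z
  have hmem := hs.mem
  have hstep₁ := hstep b h f hf hL hne _ _ _ hs.shift
  choose ε hε0 hε hεst using fun t => hstep₁ t (hmem t)
  have hsum := SProxALM.sum_sq_le_of_step hκ (fun t => hlow _ (hmem t) _ _) hε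
  -- The delay is 2: one for the shifted run, one because a step certifies its endpoint.
  refine ⟨fun xbar ybar hcl => SProxALM.isKKTPoint_of_mapClusterPt hL
    (SProxALM.tendsto_zero_of_sum_sq_le hsum) 2 hεst hcl, ?_⟩
  suffices hB : ∃ B > 0, (x 0 ∈ SProxALM.polyhedron G h →
      B = κ * (SProxALM.potential f A b G h ρ p (x 0) (y 0) (z 0) - flow)) ∧
      ∀ t : ℕ, 0 < t → ∃ s < t,
        SProxALM.IsEpsStationary f A b G h (√B / √(t : ℝ)) (x (s + 1)) (y (s + 1)) by
    obtain ⟨B, hB0, hB, hrate⟩ := hB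
    exact ⟨B, hB0, hB, hrate, fun ε hε => SProxALM.exists_lt_div_sq_of_rate hB0 hrate hε⟩
  by_cases hx0 : x 0 ∈ SProxALM.polyhedron G h
  · have hall : ∀ t, x t ∈ SProxALM.polyhedron G h := fun t => by
      cases t with
      | zero => exact hx0
      | succ t => exact hmem t
    choose η hη0 hη hηst using fun t => hstep b h f hf hL hne x y z hs t (hall t)
    have hsum' := SProxALM.sum_sq_le_of_step hκ (fun t => hlow _ (hall t) _ _) hη
    refine ⟨_, mul_pos hκ (sub_pos.2 (hlow _ hx0 (y 0) (z 0))), fun _ => rfl, fun t ht => ?_⟩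
    obtain ⟨s, hst, hle⟩ := SProxALM.exists_le_sqrt_div_sqrt hsum' ht
    exact ⟨s, hst, (hηst s).mono hle⟩
  · obtain ⟨ε₀, hε₀, hε₀st⟩ := SProxALM.exists_isEpsStationary f A b (hmem 0) (y 1)
    set B₁ := κ * (SProxALM.potential f A b G h ρ p (x 1) (y 1) (z 1) - flow) with hB₁
    have hB₁0 : 0 < B₁ := mul_pos hκ (sub_pos.2 (hlow _ (hmem 0) _ _))
    -- For `t ≥ 2` the shifted run has `t - 1 ≥ t/2` steps, hence the factor 2; for `t = 1` the
    -- residual `ε₀` of `x 1` is used.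
    refine ⟨2 * B₁ + ε₀ ^ 2, by positivity, fun hx => absurd hx hx0, fun t ht => ?_⟩
    rcases Nat.lt_or_ge 1 t with h1 | h1
    · obtain ⟨s, hst, hle⟩ := SProxALM.exists_le_sqrt_div_sqrt hsum (Nat.sub_pos_of_lt h1)
      refine ⟨s + 1, by omega, (hεst s).mono (hle.trans ?_)⟩
      have ht2 : (2 : ℝ) ≤ t := by exact_mod_cast h1
      rw [Nat.cast_sub h1.le, Nat.cast_one, ← Real.sqrt_div' _ (by linarith),
        ← Real.sqrt_div' _ (by linarith)]
      refine Real.sqrt_le_sqrt ?_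
      rw [div_le_div_iff₀ (by linarith) (by linarith)]
      have q1 := mul_nonneg hB₁0.le (sub_nonneg.2 ht2)
      have q2 := mul_nonneg (sq_nonneg ε₀) (by linarith : (0 : ℝ) ≤ t - 1)
      change B₁ * t ≤ _
      linarith
    · obtain rfl : t = 1 := by omega
      refine ⟨0, zero_lt_one, hε₀st.mono ?_⟩
      rw [Nat.cast_one, Real.sqrt_one, div_one]
      exact Real.le_sqrt_of_sq_le (by linarith)
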